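/- Let $\mathbf F$ be an algebraically closed field, of arbitrary characteristic, complete with respect to a non-Archimedean absolute value $|\cdot|$, and let $m\ge 0$ be an integer. Let $\mathcal E_m$ be the ring of entire functions on $\mathbf A^m$, i.e. of formal power series $f=\sum_\gamma a_\gamma z^\gamma$ in $z=(z_1,\dots,z_m)$ with $a_\gamma\in\mathbf F$ and $\lim_{|\gamma|\to\infty}|a_\gamma|\,r_1^{\gamma_1}\cdots r_m^{\gamma_m}=0$ for all $m$-tuples $(r_1,\dots,r_m)$ of non-negative real numbers. For $r>0$ put $|f|_r=\sup_\gamma|a_\gamma|r^{|\gamma|}$, where $|\gamma|=\gamma_1+\dots+\gamma_m$. For a nonzero $f\in\mathcal E_m$, a radical $R(f)$ of $f$ is a least common multiple in $\mathcal E_m$ of the functions $h_j=f/g_j$, $1\le j\le m$, where $g_j=\gcd(f,\partial f/\partial z_j)$ is a greatest common divisor in $\mathcal E_m$; it is determined up to a nonzero constant factor. Let $f_0,f_1,f_2\in\mathcal E_m$ with $f_2=f_0+f_1$, and suppose that $f_0$ and $f_1$ are relatively prime in $\mathcal E_m$ (every common divisor is a unit). If $\mathbf F$ has characteristic zero, assume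 that at least one of $f_0,f_1$ is non-constant. If $\mathbf F$ has positive characteristic $p$, assume that at least one of $f_0,f_1$ is not a $p$-th power in $\mathcal E_m$. Then $f_0f_1f_2$ has a radical, and for every radical $R(f_0f_1f_2)$ and every $r_0>0$ there is a constant $C$ such that for all $r\ge r_0$, $$\max_{0\le i\le 2}\log|f_i|_r\le\log|R(f_0f_1f_2)|_r-\log r+C.$$ -/

import Mathlib

namespace NonArchEntire

open Filter Topology MvPowerSeries

noncomputable section

/-- The ring of entire functions in `m` variables over `F`: formal power series
`∑ a_γ z^γ` such that `‖a_γ‖ c^γ → 0` as `|γ| → ∞` for every tuple `c` of non-negative reals.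
(On multi-indices in `m` variables, `|γ| → ∞` is the cofinite filter, which is the one used
in `MvPowerSeries.IsRestricted`.) -/
def Entire (m : ℕ) (F : Type*) [NormedField F] [IsUltrametricDist F] :
    Subring (MvPowerSeries (Fin m) F) where
  carrier := {f | ∀ c : Fin m → ℝ, (∀ i, 0 ≤ c i) → IsRestricted c f}
  zero_mem' := fun c _ => isRestricted_zero c
  one_mem' := fun c _ => isRestricted_one c
  add_mem' := fun hf hg c hc => isRestricted.add c (hf c hc) (hg c hc)
  neg_mem' := fun hf c hc => isRestricted.neg c (hf c hc)
  mul_mem' := fun hf hg c hc => isRestricted.mul c (hf c hc) (hg c hc)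

/-- Formal partial derivatives of entire functions are entire. -/
theorem pderiv_mem_entire {m : ℕ} {F : Type*} [NormedField F] [IsUltrametricDist F]
    (j : Fin m) {f : MvPowerSeries (Fin m) F} (hf : f ∈ Entire m F) :
    MvPowerSeries.pderiv F j f ∈ Entire m F := by
  intro c hc
  have hb := hf (fun i => max (c i) 1) (fun i => le_trans (hc i) (le_max_left _ _))
  have hinj : Function.Injective (fun n : Fin m →₀ ℕ => n + Finsupp.single j (1 : ℕ)) :=
    fun a b h => add_right_cancel h
  have hb' := hb.comp hinj.tendsto_cofinite
  refine squeeze_zero (fun n => ?_) (fun n => ?_) hb'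
  · exact mul_nonneg (norm_nonneg _) (Finset.prod_nonneg fun i _ => pow_nonneg (hc i) _)
  · simp only [Function.comp_apply, coeff_pderiv, norm_mul]
    have h1 : ‖((n j : F) + 1)‖ ≤ 1 := by
      have := IsUltrametricDist.norm_natCast_le_one F (n j + 1)
      simpa using this
    have h2 : n.prod (fun i k => c i ^ k) ≤
        (n + Finsupp.single j (1 : ℕ)).prod (fun i k => (max (c i) 1) ^ k) := by
      rw [Finsupp.prod_fintype _ _ (by simp), Finsupp.prod_fintype _ _ (by simp)]
      refine Finset.prod_le_prod (fun i _ => pow_nonneg (hc i) _) (fun i _ => ?_)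
      calc c i ^ n i ≤ (max (c i) 1) ^ n i := pow_le_pow_left₀ (hc i) (le_max_left _ _) _
        _ ≤ (max (c i) 1) ^ ((n + Finsupp.single j (1 : ℕ)) i) :=
          pow_le_pow_right₀ (le_max_right _ _) (by simp)
    refine mul_le_mul (mul_le_of_le_one_right (norm_nonneg _) h1) h2 ?_ (norm_nonneg _)
    exact Finset.prod_nonneg fun i _ => pow_nonneg (hc i) _

/-- The partial derivative `∂f/∂z_j` of an entire function, as an entire function. -/
def partialDeriv {m : ℕ} {F : Type*} [NormedField F] [IsUltrametricDist F]
    (j : Fin m) (f : Entire m F) : Entire m F :=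
  ⟨MvPowerSeries.pderiv F j (f : MvPowerSeries (Fin m) F), pderiv_mem_entire j f.2⟩

/-- The absolute value `|f|_r = sup_γ ‖a_γ‖ r^{|γ|}` of an entire function `f = ∑ a_γ z^γ`. -/
def absR {m : ℕ} {F : Type*} [NormedField F] [IsUltrametricDist F]
    (r : ℝ) (f : Entire m F) : ℝ :=
  MvPowerSeries.gaussNorm (fun a : F => ‖a‖) (fun _ : Fin m => r)
    (f : MvPowerSeries (Fin m) F)

/-- The entire function `f` is constant. -/
def IsConstant {m : ℕ} {F : Type*} [NormedField F] [IsUltrametricDist F]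
    (f : Entire m F) : Prop :=
  ∃ a : F, (f : MvPowerSeries (Fin m) F) = MvPowerSeries.C a

/-- `g` is a greatest common divisor of `a` and `b` (with respect to divisibility). -/
def IsGreatestCommonDivisor {A : Type*} [CommRing A] (a b g : A) : Prop :=
  g ∣ a ∧ g ∣ b ∧ ∀ d : A, d ∣ a → d ∣ b → d ∣ g

/-- `l` is a least common multiple of the family `h` (with respect to divisibility). -/
def IsLeastCommonMultiple {A ι : Type*} [CommRing A] (h : ι → A) (l : A) : Prop :=
  (∀ j, h j ∣ l) ∧ ∀ k : A, (∀ j, h j ∣ k) → l ∣ k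

/-- `R` is a radical of the entire function `f`: for some choice of greatest common divisors
`g_j = gcd(f, ∂f/∂z_j)` and with `h_j = f / g_j`, `R` is a least common multiple of the `h_j`.
For `f ≠ 0` a radical is unique up to a unit, that is, up to a nonzero constant. -/
def IsRadicalOf {m : ℕ} {F : Type*} [NormedField F] [IsUltrametricDist F]
    (f R : Entire m F) : Prop :=
  ∃ g h : Fin m → Entire m F,
    (∀ j, IsGreatestCommonDivisor f (partialDeriv j f) (g j)) ∧
    (∀ j, f = g j * h j) ∧
    IsLeastCommonMultiple h R

end

end NonArchEntire

/-!
The inequality comes from the Wronskian `W = f₀ ∂f₁ - f₁ ∂f₀` for a partial derivative `∂ = ∂/∂z_j`.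
If `W` vanished for every `j`, coprimality would give `f_i ∣ ∂f_i`; as `|∂f|_r ≤ |f|_r / r`, this
forces `∂f_i = 0` (`partialDeriv_eq_zero_of_dvd`). Then `f₀` and `f₁` are both constant in
characteristic zero, and both `p`-th powers in characteristic `p`
(`exists_pow_eq_of_partialDeriv_eq_zero`), which is excluded. So fix `j` with `W ≠ 0`. Because
`f₂ = f₀ + f₁`, any two of the three functions have the same Wronskian up to sign, and every common
divisor `g` of `f₀ f₁ f₂` and its derivative divides `W` (`dvd_wronskian`). Writing
`f₀ f₁ f₂ = g h` and comparing `|g|_r ≤ const · |W|_r` with `|W|_r ≤ |f_a|_r |f_b|_r / r` bounds the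
remaining `|f_c|_r` by `const · |h|_r / r`, and `h` divides the radical (`exists_log_absR_le`).

Both the splitting of `g` into factors of the `f_i` and the existence of the radical rest on the
existence of greatest common divisors of entire functions (`exists_gcd_entire`). On a closed
polydisc of radius `R` the overconvergent series, those converging on some larger polydisc, form a
unique factorization domain (`uniqueFactorizationMonoid_overconv`), by induction on the number of
variables. The residue field of `F` is infinite, so a linear change of coordinates makes a given
series `f` regular: on polydiscs slightly longer in the direction of `X 0` one monomial `X 0 ^ s`
strictly dominates. There Weierstrass division is the fixed point of a contraction, `f` is a unit
times a monic polynomial in `X 0` over the series in the other variables, and prime factors of that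
polynomial remain prime among series (`prime_polyEmb`).

The greatest common divisors formed on growing polydiscs decrease for divisibility on each fixed
polydisc, hence stabilize up to units. Units normalized to have constant term one have Gauss norm
one, so by the Schwarz lemma (`NormLE.sub_one`) the correcting units tend to one quickly enough for
their product to converge, and the local greatest common divisors are represented by a single
entire function (`exists_assocOn_of_forall_succ`).
-/

namespace NonArchEntire

open Filter Topology MvPowerSeries

noncomputable section

/-! ### Weighted bounds on coefficients -/

section Weights

variable {σ : Type*}

/-- The weight `v^γ = ∏ v_i^{γ_i}` of a multi-index `γ`. -/
def wt (v : σ → ℝ) (γ : σ →₀ ℕ) : ℝ := γ.prod fun i k => v i ^ k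

theorem wt_zero (v : σ → ℝ) : wt v 0 = 1 := by simp [wt]

theorem wt_add (v : σ → ℝ) (γ δ : σ →₀ ℕ) : wt v (γ + δ) = wt v γ * wt v δ := by
  classical
  exact Finsupp.prod_add_index' (by simp) (by simp [pow_add])

theorem wt_single (v : σ → ℝ) (j : σ) (s : ℕ) : wt v (Finsupp.single j s) = v j ^ s := by
  simp [wt]

theorem wt_pos {v : σ → ℝ} (hv : ∀ i, 0 < v i) (γ : σ →₀ ℕ) : 0 < wt v γ :=
  Finset.prod_pos fun i _ => pow_pos (hv i) _

theorem wt_le_wt {v w : σ → ℝ} (hv : ∀ i, 0 < v i) (h : ∀ i, v i ≤ w i) (γ : σ →₀ ℕ) :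
    wt v γ ≤ wt w γ :=
  Finset.prod_le_prod (fun i _ => pow_nonneg (hv i).le _)
    fun i _ => pow_le_pow_left₀ (hv i).le (h i) _

theorem wt_const (r : ℝ) (γ : σ →₀ ℕ) : wt (fun _ => r) γ = r ^ γ.degree := by
  rw [wt, Finsupp.prod, Finset.prod_pow_eq_pow_sum]; rfl

end Weights

section Bounds

variable {σ F : Type*} [NormedField F] {v w : σ → ℝ} {C D : ℝ} {f g : MvPowerSeries σ F}

/-- `f` has Gauss norm at most `C` for the weights `v`: `‖a_γ‖ v^γ ≤ C` for all `γ`. -/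
def NormLE (v : σ → ℝ) (C : ℝ) (f : MvPowerSeries σ F) : Prop :=
  ∀ γ, ‖coeff γ f‖ * wt v γ ≤ C

theorem NormLE.nonneg (hf : NormLE v C f) : 0 ≤ C := by
  have := hf 0
  rw [wt_zero, mul_one] at this
  exact (norm_nonneg _).trans this

theorem NormLE.mono (hf : NormLE v C f) (h : C ≤ D) : NormLE v D f :=
  fun γ => (hf γ).trans h

theorem NormLE.mono_weight (hf : NormLE w C f) (hv : ∀ i, 0 < v i) (h : ∀ i, v i ≤ w i) :
    NormLE v C f :=
  fun γ => (mul_le_mul_of_nonneg_left (wt_le_wt hv h γ) (norm_nonneg _)).trans (hf γ)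

theorem NormLE.neg (hf : NormLE v C f) : NormLE v C (-f) := fun γ => by
  rw [map_neg, norm_neg]; exact hf γ

theorem normLE_zero (hC : 0 ≤ C) : NormLE v C (0 : MvPowerSeries σ F) := fun γ => by
  simpa using hC

theorem normLE_monomial (hv : ∀ i, 0 < v i) (γ : σ →₀ ℕ) (a : F) :
    NormLE v (‖a‖ * wt v γ) (monomial γ a) := fun δ => by
  classical
  rw [coeff_monomial]
  split_ifs with h
  · rw [h]
  · simpa using mul_nonneg (norm_nonneg a) (wt_pos hv γ).le

theorem normLE_one (hv : ∀ i, 0 < v i) : NormLE v 1 (1 : MvPowerSeries σ F) := by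
  have := normLE_monomial hv 0 (1 : F)
  rwa [wt_zero, norm_one, mul_one, monomial_zero_one] at this

theorem normLE_X_pow (hv : ∀ i, 0 < v i) (j : σ) (s : ℕ) :
    NormLE v (v j ^ s) (X j ^ s : MvPowerSeries σ F) := by
  have := normLE_monomial hv (Finsupp.single j s) (1 : F)
  rwa [wt_single, norm_one, one_mul, ← X_pow_eq] at this

theorem eq_zero_of_normLE_mul_pow {ε : ℝ} (hv : ∀ i, 0 < v i) (hε : 0 ≤ ε) (hε1 : ε < 1)
    (h : ∀ k : ℕ, NormLE v (ε ^ k * C) f) : f = 0 := by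
  ext γ
  have ht : Tendsto (fun k : ℕ => ε ^ k * C) atTop (𝓝 0) := by
    simpa using (tendsto_pow_atTop_nhds_zero_of_lt_one hε hε1).mul_const C
  have h0 : ‖coeff γ f‖ * wt v γ ≤ 0 := ge_of_tendsto' ht fun k => h k γ
  have := nonpos_of_mul_nonpos_left h0 (wt_pos hv γ)
  simpa using this

variable [IsUltrametricDist F]

theorem NormLE.add (hv : ∀ i, 0 < v i) (hf : NormLE v C f) (hg : NormLE v C g) :
    NormLE v C (f + g) := fun γ => by
  rw [map_add]
  refine (mul_le_mul_of_nonneg_right (IsUltrametricDist.norm_add_le_max _ _)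
    (wt_pos hv γ).le).trans ?_
  rw [max_mul_of_nonneg _ _ (wt_pos hv γ).le]
  exact max_le (hf γ) (hg γ)

theorem NormLE.sub (hv : ∀ i, 0 < v i) (hf : NormLE v C f) (hg : NormLE v C g) :
    NormLE v C (f - g) := by
  rw [sub_eq_add_neg]; exact hf.add hv hg.neg

theorem NormLE.mul (hv : ∀ i, 0 < v i) (hf : NormLE v C f) (hg : NormLE v D g) :
    NormLE v (C * D) (f * g) := fun γ => by
  classical
  rw [coeff_mul, ← le_div_iff₀ (wt_pos hv γ)]
  refine IsUltrametricDist.norm_sum_le_of_forall_le_of_nonneg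
    (div_nonneg (mul_nonneg hf.nonneg hg.nonneg) (wt_pos hv γ).le) fun p hp => ?_
  rw [le_div_iff₀ (wt_pos hv γ), ← Finset.HasAntidiagonal.mem_antidiagonal.mp hp, wt_add,
    norm_mul]
  calc _ = (‖coeff p.1 f‖ * wt v p.1) * (‖coeff p.2 g‖ * wt v p.2) := by ring
    _ ≤ C * D := mul_le_mul (hf _) (hg _) (mul_nonneg (norm_nonneg _) (wt_pos hv _).le) hf.nonneg

end Bounds

/-! ### Weierstrass division by a dominated series -/

section Shift

variable {σ F : Type*} [Field F]

/-- The quotient of a power series by `X_j ^ s`, forgetting the terms not divisible by it. -/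
def shift (j : σ) (s : ℕ) : MvPowerSeries σ F →+ MvPowerSeries σ F where
  toFun f := fun γ => coeff (γ + Finsupp.single j s) f
  map_zero' := rfl
  map_add' _ _ := rfl

theorem coeff_shift (j : σ) (s : ℕ) (f : MvPowerSeries σ F) (γ : σ →₀ ℕ) :
    coeff γ (shift j s f) = coeff (γ + Finsupp.single j s) f := rfl

theorem shift_X_pow_mul (j : σ) (s : ℕ) (f : MvPowerSeries σ F) :
    shift j s (X j ^ s * f) = f := by
  classical
  ext γ
  rw [coeff_shift, X_pow_eq, add_comm γ, coeff_add_monomial_mul, one_mul]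

theorem shift_zero_right (j : σ) (f : MvPowerSeries σ F) : shift j 0 f = f := by
  ext γ; simp [coeff_shift]

theorem shift_eq_zero_iff {j : σ} {s : ℕ} {f : MvPowerSeries σ F} :
    shift j s f = 0 ↔ ∀ γ : σ →₀ ℕ, s ≤ γ j → coeff γ f = 0 := by
  classical
  constructor
  · intro h γ hγ
    have hle : Finsupp.single j s ≤ γ := by simpa using hγ
    rw [← tsub_add_cancel_of_le hle, ← coeff_shift, h, map_zero]
  · intro h
    ext γ
    rw [coeff_shift, h _ (by simp), map_zero]

end Shift

section Division

variable {σ F : Type*} [NormedField F] {v : σ → ℝ} {j : σ} {s : ℕ}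
  {C ε : ℝ} {f g ω q : MvPowerSeries σ F}

theorem NormLE.shift (hv : ∀ i, 0 < v i) (hf : NormLE v (C * v j ^ s) f) :
    NormLE v C (shift j s f) := fun γ => by
  have := hf (γ + Finsupp.single j s)
  rw [wt_add, wt_single, ← mul_assoc] at this
  exact le_of_mul_le_mul_right this (pow_pos (hv j) s)

open scoped MvPowerSeries.WithPiTopology in
theorem continuous_shift (j : σ) (s : ℕ) :
    Continuous (NonArchEntire.shift j s : MvPowerSeries σ F →+ MvPowerSeries σ F) :=
  continuous_pi fun γ => MvPowerSeries.WithPiTopology.continuous_coeff F (γ + Finsupp.single j s)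

theorem shift_mul_eq (j : σ) (s : ℕ) (q ω : MvPowerSeries σ F) :
    shift j s (q * ω) = q + shift j s (q * (ω - X j ^ s)) := by
  have : q * ω = X j ^ s * q + q * (ω - X j ^ s) := by ring
  rw [this, map_add, shift_X_pow_mul]

variable [IsUltrametricDist F]

theorem normLE_shift_mul_sub (hv : ∀ i, 0 < v i) (hω : NormLE v (ε * v j ^ s) (ω - X j ^ s))
    (hq : NormLE v C q) : NormLE v (ε * C) (NonArchEntire.shift j s (q * (ω - X j ^ s))) := by
  apply NormLE.shift hv
  exact (hq.mul hv hω).mono (le_of_eq (by ring))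

/-- Uniqueness in Weierstrass division: a bounded quotient of zero vanishes. -/
theorem eq_zero_of_shift_mul_eq_zero (hv : ∀ i, 0 < v i) (hε : 0 ≤ ε) (hε1 : ε < 1)
    (hω : NormLE v (ε * v j ^ s) (ω - X j ^ s)) (hq : NormLE v C q)
    (h : shift j s (q * ω) = 0) : q = 0 := by
  have hfix : q = - shift j s (q * (ω - X j ^ s)) := by
    rw [shift_mul_eq] at h
    exact eq_neg_of_add_eq_zero_left h
  refine eq_zero_of_normLE_mul_pow (C := C) hv hε hε1 fun k => ?_
  induction k with
  | zero => simpa using hq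
  | succ k ih =>
    rw [hfix]
    exact (normLE_shift_mul_sub hv hω ih).neg.mono (le_of_eq (by ring))

open scoped MvPowerSeries.WithPiTopology in
/-- Existence in Weierstrass division by a series in which `X_j ^ s` strictly dominates: the
quotient is the fixed point of a contraction, hence the sum of a geometric series. -/
theorem exists_shift_sub_mul_eq_zero [CompleteSpace F] (hv : ∀ i, 0 < v i) (hε : 0 ≤ ε)
    (hε1 : ε < 1) (hω : NormLE v (ε * v j ^ s) (ω - X j ^ s)) (hg : NormLE v C g) :
    ∃ q, (∃ C', NormLE v C' q) ∧ shift j s (g - q * ω) = 0 := by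
  let T : MvPowerSeries σ F →+ MvPowerSeries σ F :=
    -((shift j s).comp (AddMonoidHom.mulRight (ω - X j ^ s)))
  have hT : ∀ q, T q = - shift j s (q * (ω - X j ^ s)) := fun q => rfl
  have hTc : Continuous T :=
    ((continuous_shift j s).comp (continuous_mul_const (ω - X j ^ s))).neg
  let C₀ := C / v j ^ s
  have hvj : 0 < v j ^ s := pow_pos (hv j) s
  have h0 : NormLE v C₀ (shift j s g) := NormLE.shift hv (by
    rwa [div_mul_cancel₀ _ hvj.ne'])
  let a : ℕ → MvPowerSeries σ F := fun k => T^[k] (shift j s g)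
  have ha : ∀ k, NormLE v (ε ^ k * C₀) (a k) := by
    intro k
    induction k with
    | zero => simpa [a] using h0
    | succ k ih =>
      have : a (k + 1) = T (a k) := Function.iterate_succ_apply' _ _ _
      rw [this, hT]
      exact (normLE_shift_mul_sub hv hω ih).neg.mono (le_of_eq (by ring))
  have hgeo : HasSum (fun k : ℕ => ε ^ k * C₀) ((1 - ε)⁻¹ * C₀) :=
    (hasSum_geometric_of_lt_one hε hε1).mul_right C₀
  have hle : ∀ γ k, ‖coeff γ (a k)‖ ≤ (ε ^ k * C₀) / wt v γ := fun γ k => by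
    rw [le_div_iff₀ (wt_pos hv γ)]; exact ha k γ
  have hsum : Summable a := by
    rw [WithPiTopology.summable_iff_summable_coeff]
    intro γ
    exact Summable.of_norm_bounded ((hgeo.div_const (wt v γ)).summable) (hle γ)
  obtain ⟨q, hq⟩ := hsum
  refine ⟨q, ⟨(1 - ε)⁻¹ * C₀, fun γ => ?_⟩, ?_⟩
  · rw [← le_div_iff₀ (wt_pos hv γ)]
    have h1 := (WithPiTopology.hasSum_iff_hasSum_coeff.mp hq) γ
    rw [← h1.tsum_eq]
    exact tsum_of_norm_bounded (hgeo.div_const (wt v γ)) (hle γ)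
  · have h1 : HasSum (fun k => a (k + 1)) (T q) := by
      exact (hq.map T hTc).congr_fun fun k => Function.iterate_succ_apply' _ _ _
    have h2 : HasSum (fun k => a (k + 1)) (q - a 0) := by
      have := (hasSum_nat_add_iff' 1).mpr hq
      simpa using this
    have h3 : T q = q - shift j s g := h1.unique h2
    rw [hT] at h3
    rw [map_sub, shift_mul_eq]
    linear_combination h3

/-- The Weierstrass quotient of `X_j ^ s` by a series in which `X_j ^ s` strictly dominates is
a unit with bounded inverse. -/
theorem exists_mul_eq_one_of_shift_eq_zero [CompleteSpace F] (hv : ∀ i, 0 < v i) (hε : 0 ≤ ε)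
    (hε1 : ε < 1) (hω : NormLE v (ε * v j ^ s) (ω - X j ^ s)) (hq : NormLE v C q)
    (h : shift j s (X j ^ s - q * ω) = 0) :
    ∃ q', (∃ C', NormLE v C' q') ∧ q' * q = 1 := by
  have hq1 : q - 1 = - shift j s (q * (ω - X j ^ s)) := by
    have h1 : shift j s (X j ^ s : MvPowerSeries σ F) = 1 := by
      simpa using shift_X_pow_mul j s (1 : MvPowerSeries σ F)
    rw [map_sub, shift_mul_eq, h1, sub_eq_zero] at h
    rw [h]; ring
  have hfix : q - 1 = - (shift j s (1 * (ω - X j ^ s)) + shift j s ((q - 1) * (ω - X j ^ s))) := by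
    rw [← map_add, ← add_mul, add_sub_cancel]; exact hq1
  have h1 : NormLE v (ε * 1) (shift j s (1 * (ω - X j ^ s))) :=
    normLE_shift_mul_sub hv hω (normLE_one hv)
  -- The bound `ε` on `q - 1` is obtained by iterating the contraction finitely many times.
  have key : ∀ k : ℕ, NormLE v (max ε (ε ^ k * max C 1)) (q - 1) := by
    intro k
    induction k with
    | zero =>
      have := (hq.mono (le_max_left C 1)).sub hv ((normLE_one hv).mono (le_max_right C 1))
      exact this.mono (by simp)
    | succ k ih =>
      rw [hfix]
      refine NormLE.neg (NormLE.add hv (h1.mono (by simp)) ((normLE_shift_mul_sub hv hω ih).mono ?_))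
      rw [mul_max_of_nonneg _ _ hε]
      refine max_le_max ?_ (le_of_eq (by ring))
      nlinarith
  obtain ⟨k, hk⟩ : ∃ k : ℕ, ε ^ k * max C 1 < (1 + ε) / 2 := by
    have ht : Tendsto (fun k : ℕ => ε ^ k * max C 1) atTop (𝓝 0) := by
      simpa using (tendsto_pow_atTop_nhds_zero_of_lt_one hε hε1).mul_const (max C 1)
    exact (ht.eventually_lt_const (by linarith)).exists
  have hq2 : NormLE v ((1 + ε) / 2 * v j ^ 0) (q - X j ^ 0) := by
    rw [pow_zero, pow_zero, mul_one]
    exact (key k).mono (max_le (by linarith) hk.le)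
  obtain ⟨q', hq', h'⟩ := exists_shift_sub_mul_eq_zero hv (by linarith) (by linarith) hq2
    (normLE_one hv)
  refine ⟨q', hq', ?_⟩
  rw [shift_zero_right, sub_eq_zero] at h'
  exact h'.symm

end Division

/-! ### Overconvergent power series and their polynomial subring -/

section Overconvergent

variable (R : ℝ) (n : ℕ) (F : Type*) [NormedField F] [IsUltrametricDist F]

/-- The ring of overconvergent power series on the closed polydisc of radius `R` in `n`
variables: the coefficients are bounded for some radius `ρ > R`. -/
def Overconv : Subring (MvPowerSeries (Fin n) F) where
  carrier := {f | ∃ ρ : ℝ, R < ρ ∧ 0 < ρ ∧ ∃ C, NormLE (fun _ => ρ) C f}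
  zero_mem' := ⟨max R 0 + 1, by grind, by grind, 0, normLE_zero le_rfl⟩
  one_mem' := ⟨max R 0 + 1, by grind, by grind, 1, normLE_one fun _ => by grind⟩
  add_mem' := by
    rintro f g ⟨ρ, hρ, hρ0, C, hf⟩ ⟨τ, hτ, hτ0, D, hg⟩
    have h0 : 0 < min ρ τ := lt_min hρ0 hτ0
    refine ⟨min ρ τ, lt_min hρ hτ, h0, max C D, ?_⟩
    exact ((hf.mono_weight (fun _ => h0) fun _ => min_le_left _ _).mono (le_max_left _ _)).add
      (fun _ => h0) ((hg.mono_weight (fun _ => h0) fun _ => min_le_right _ _).mono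
        (le_max_right _ _))
  neg_mem' := by
    rintro f ⟨ρ, hρ, hρ0, C, hf⟩
    exact ⟨ρ, hρ, hρ0, C, hf.neg⟩
  mul_mem' := by
    rintro f g ⟨ρ, hρ, hρ0, C, hf⟩ ⟨τ, hτ, hτ0, D, hg⟩
    have h0 : 0 < min ρ τ := lt_min hρ0 hτ0
    refine ⟨min ρ τ, lt_min hρ hτ, h0, C * D, ?_⟩
    exact (hf.mono_weight (fun _ => h0) fun _ => min_le_left _ _).mul
      (fun _ => h0) (hg.mono_weight (fun _ => h0) fun _ => min_le_right _ _)

variable {R n F}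

theorem mem_overconv_iff {f : MvPowerSeries (Fin n) F} :
    f ∈ Overconv R n F ↔ ∃ ρ : ℝ, R < ρ ∧ 0 < ρ ∧ ∃ C, NormLE (fun _ => ρ) C f := Iff.rfl

theorem monomial_mem_overconv (γ : Fin n →₀ ℕ) (a : F) : monomial γ a ∈ Overconv R n F :=
  ⟨max R 0 + 1, by grind, by grind, _, normLE_monomial (fun _ => by grind) γ a⟩

theorem X_mem_overconv (i : Fin n) : (X i : MvPowerSeries (Fin n) F) ∈ Overconv R n F :=
  monomial_mem_overconv _ _

theorem mem_overconv_of_normLE {f : MvPowerSeries (Fin (n + 1)) F} {v : Fin (n + 1) → ℝ} {C : ℝ}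
    (hR : 0 ≤ R) (hv : ∀ i, R < v i) (hf : NormLE v C f) : f ∈ Overconv R (n + 1) F := by
  let ρ := Finset.univ.inf' Finset.univ_nonempty v
  have hρ : R < ρ := (Finset.lt_inf'_iff _).mpr fun i _ => hv i
  exact ⟨ρ, hρ, hR.trans_lt hρ, C, hf.mono_weight (fun _ => hR.trans_lt hρ)
    fun i => Finset.inf'_le _ (Finset.mem_univ i)⟩

theorem wt_cons (v : Fin (n + 1) → ℝ) (k : ℕ) (x : Fin n →₀ ℕ) :
    wt v (x.cons k) = v 0 ^ k * wt (fun i => v i.succ) x := by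
  rw [wt, wt, Finsupp.prod_fintype _ _ (by simp), Finsupp.prod_fintype _ _ (by simp),
    Fin.prod_univ_succ]
  simp

/-- The inclusion of series in `n` variables as series in `n + 1` variables not involving `X 0`. -/
def constEmb : Overconv R n F →+* Overconv R (n + 1) F :=
  RingHom.codRestrict (((MvPowerSeries.finSuccEquiv F n).symm.toRingHom.comp PowerSeries.C).comp
    (Overconv R n F).subtype) (Overconv R (n + 1) F) fun a => by
    obtain ⟨ρ, hρ, hρ0, C, ha⟩ := mem_overconv_iff.mp a.2
    refine ⟨ρ, hρ, hρ0, C, fun γ => ?_⟩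
    obtain ⟨k, x, rfl⟩ : ∃ k x, γ = Finsupp.cons k x := ⟨γ 0, γ.tail, (Finsupp.cons_tail γ).symm⟩
    rw [← MvPowerSeries.coeff_coeff_finSuccEquiv, wt_cons]
    have : (MvPowerSeries.finSuccEquiv F n) ((((MvPowerSeries.finSuccEquiv F n).symm.toRingHom.comp
      PowerSeries.C).comp (Overconv R n F).subtype) a) = PowerSeries.C (a : MvPowerSeries _ F) :=
      (MvPowerSeries.finSuccEquiv F n).apply_symm_apply _
    rw [this, PowerSeries.coeff_C]
    split_ifs with h
    · subst h
      simpa using ha x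
    · simpa using ha.nonneg

theorem finSuccEquiv_constEmb (a : Overconv R n F) :
    MvPowerSeries.finSuccEquiv F n (constEmb a : MvPowerSeries (Fin (n + 1)) F) =
      PowerSeries.C (a : MvPowerSeries (Fin n) F) :=
  (MvPowerSeries.finSuccEquiv F n).apply_symm_apply _

/-- The inclusion of polynomials in `X 0` over the overconvergent series in the remaining
variables. -/
def polyEmb : Polynomial (Overconv R n F) →+* Overconv R (n + 1) F :=
  Polynomial.eval₂RingHom constEmb ⟨X 0, X_mem_overconv 0⟩

theorem finSuccEquiv_polyEmb (P : Polynomial (Overconv R n F)) :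
    MvPowerSeries.finSuccEquiv F n (polyEmb P : MvPowerSeries (Fin (n + 1)) F) =
      (P.map (Overconv R n F).subtype : PowerSeries (MvPowerSeries (Fin n) F)) := by
  have : (((MvPowerSeries.finSuccEquiv F n).toRingEquiv.toRingHom).comp
      (Overconv R (n + 1) F).subtype).comp polyEmb =
      Polynomial.coeToPowerSeries.ringHom.comp
        (Polynomial.mapRingHom (Overconv R n F).subtype) := by
    refine Polynomial.ringHom_ext (fun a => ?_) ?_
    · simp [polyEmb, finSuccEquiv_constEmb]
    · simp [polyEmb]
  exact DFunLike.congr_fun this P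

theorem coeff_polyEmb (P : Polynomial (Overconv R n F)) (k : ℕ) (x : Fin n →₀ ℕ) :
    coeff (x.cons k) (polyEmb P : MvPowerSeries (Fin (n + 1)) F) =
      coeff x (P.coeff k : MvPowerSeries (Fin n) F) := by
  rw [← MvPowerSeries.coeff_coeff_finSuccEquiv, finSuccEquiv_polyEmb, Polynomial.coeff_coe,
    Polynomial.coeff_map]
  rfl

theorem polyEmb_injective : Function.Injective (polyEmb : _ →+* Overconv R (n + 1) F) := by
  intro P Q h
  ext k x
  rw [← coeff_polyEmb, ← coeff_polyEmb, h]

theorem shift_polyEmb_eq_zero {P : Polynomial (Overconv R n F)} {s : ℕ} (hP : P.degree < s) :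
    shift 0 s (polyEmb P : MvPowerSeries (Fin (n + 1)) F) = 0 := by
  rw [shift_eq_zero_iff]
  intro γ hγ
  rw [← Finsupp.cons_tail γ, coeff_polyEmb, Polynomial.coeff_eq_zero_of_degree_lt]
  · rfl
  · exact hP.trans_le (by exact_mod_cast hγ)

theorem exists_polyEmb_eq {r : Overconv R (n + 1) F} {s : ℕ}
    (hr : shift 0 s (r : MvPowerSeries (Fin (n + 1)) F) = 0) :
    ∃ P : Polynomial (Overconv R n F), P.degree < s ∧ polyEmb P = r := by
  obtain ⟨ρ, hρ, hρ0, C, hC⟩ := mem_overconv_iff.mp r.2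
  let c : ℕ → Overconv R n F := fun k =>
    ⟨fun x => coeff (x.cons k) (r : MvPowerSeries (Fin (n + 1)) F), ρ, hρ, hρ0, C / ρ ^ k,
      fun x => by
        have := hC (x.cons k)
        rw [wt_cons] at this
        rw [le_div_iff₀ (pow_pos hρ0 k)]
        calc ‖coeff (x.cons k) (r : MvPowerSeries (Fin (n + 1)) F)‖ * wt _ x * ρ ^ k = _ := by ring
          _ ≤ C := this⟩
  have hc : ∀ k x, coeff x (c k : MvPowerSeries (Fin n) F) =
    coeff (x.cons k) (r : MvPowerSeries (Fin (n + 1)) F) := fun k x => rfl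
  let P : Polynomial (Overconv R n F) := ∑ k ∈ Finset.range s, Polynomial.monomial k (c k)
  refine ⟨P, ?_, ?_⟩
  · rw [Polynomial.degree_lt_iff_coeff_zero]
    intro k hk
    simp [P, Polynomial.coeff_monomial, not_lt.mpr hk]
  · ext γ
    rw [← Finsupp.cons_tail γ, coeff_polyEmb]
    have : P.coeff (γ 0) = if γ 0 < s then c (γ 0) else 0 := by
      simp [P, Polynomial.coeff_monomial]
    rw [this]
    split_ifs with h
    · rw [hc]
    · rw [Finsupp.cons_tail, shift_eq_zero_iff.mp hr γ (not_lt.mp h)]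
      rfl

end Overconvergent

/-! ### Weierstrass preparation and prime factors -/

section Preparation

variable {R : ℝ} {n : ℕ} {F : Type*} [NormedField F] [IsUltrametricDist F]

/-- `f` is regular of order `s` in `X 0` on the polydisc of radius `R`: for polyradii arbitrarily
close to `R` from above, the monomial `X 0 ^ s` has coefficient close to one and strictly
dominates all other terms of `f`. -/
def IsRegular (R : ℝ) (s : ℕ) (f : MvPowerSeries (Fin (n + 1)) F) : Prop :=
  ∀ ρ : ℝ, R < ρ → ∃ v : Fin (n + 1) → ℝ, (∀ i, R < v i ∧ v i ≤ ρ) ∧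
    ∃ ε : ℝ, 0 ≤ ε ∧ ε < 1 ∧ NormLE v (ε * v 0 ^ s) (f - X 0 ^ s)

theorem IsRegular.exists_normLE {s : ℕ} {f : MvPowerSeries (Fin (n + 1)) F} (hR : 0 ≤ R)
    (hf : IsRegular R s f) {g : MvPowerSeries (Fin (n + 1)) F} (hg : g ∈ Overconv R (n + 1) F) :
    ∃ v : Fin (n + 1) → ℝ, (∀ i, R < v i) ∧ (∀ i, 0 < v i) ∧ (∃ C, NormLE v C g) ∧
      ∃ ε : ℝ, 0 ≤ ε ∧ ε < 1 ∧ NormLE v (ε * v 0 ^ s) (f - X 0 ^ s) := by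
  obtain ⟨ρ, hρ, hρ0, C, hC⟩ := mem_overconv_iff.mp hg
  obtain ⟨v, hv, hε⟩ := hf ρ hρ
  have hv0 : ∀ i, 0 < v i := fun i => hR.trans_lt (hv i).1
  exact ⟨v, fun i => (hv i).1, hv0, ⟨C, hC.mono_weight hv0 fun i => (hv i).2⟩, hε⟩

/-- Uniqueness in Weierstrass division by a regular series. -/
theorem IsRegular.eq_zero {s : ℕ} {f q : Overconv R (n + 1) F} (hR : 0 ≤ R)
    (hf : IsRegular R s (f : MvPowerSeries (Fin (n + 1)) F))
    (h : shift 0 s ((q * f : Overconv R (n + 1) F) : MvPowerSeries (Fin (n + 1)) F) = 0) :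
    q = 0 := by
  obtain ⟨v, -, hv0, ⟨C, hC⟩, ε, hε, hε1, hω⟩ := hf.exists_normLE hR q.2
  exact Subtype.ext (eq_zero_of_shift_mul_eq_zero hv0 hε hε1 hω hC h)

variable [CompleteSpace F]

/-- Weierstrass division by a regular series of order `s`: the remainder is a polynomial in `X 0`
of degree less than `s`. -/
theorem IsRegular.exists_div {s : ℕ} {f : Overconv R (n + 1) F} (hR : 0 ≤ R)
    (hf : IsRegular R s (f : MvPowerSeries (Fin (n + 1)) F)) (g : Overconv R (n + 1) F) :
    ∃ (q : Overconv R (n + 1) F) (P : Polynomial (Overconv R n F)),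
      P.degree < s ∧ g = q * f + polyEmb P := by
  obtain ⟨v, hv, hv0, ⟨C, hC⟩, ε, hε, hε1, hω⟩ := hf.exists_normLE hR g.2
  obtain ⟨q, ⟨C', hq⟩, h⟩ := exists_shift_sub_mul_eq_zero hv0 hε hε1 hω hC
  let q' : Overconv R (n + 1) F := ⟨q, mem_overconv_of_normLE hR hv hq⟩
  obtain ⟨P, hP, hPr⟩ := exists_polyEmb_eq (r := g - q' * f) h
  exact ⟨q', P, hP, by rw [hPr]; ring⟩

/-- Weierstrass preparation: a regular series is associated to a monic polynomial. -/
theorem IsRegular.exists_monic {s : ℕ} {f : Overconv R (n + 1) F} (hR : 0 ≤ R)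
    (hf : IsRegular R s (f : MvPowerSeries (Fin (n + 1)) F)) :
    ∃ ω : Polynomial (Overconv R n F), ω.Monic ∧ ω.degree = s ∧
      ∃ u, IsUnit u ∧ polyEmb ω = u * f := by
  let Y : Overconv R (n + 1) F := ⟨X 0, X_mem_overconv 0⟩
  obtain ⟨q, P, hP, h⟩ := hf.exists_div hR (Y ^ s)
  have hY : polyEmb (Polynomial.X ^ s : Polynomial (Overconv R n F)) = Y ^ s := by
    simp [polyEmb, Y]
  refine ⟨Polynomial.X ^ s - P, ?_, ?_, q, ?_, ?_⟩
  · exact Polynomial.monic_X_pow_sub hP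
  · rw [Polynomial.degree_sub_eq_left_of_degree_lt] <;> simp [hP]
  · obtain ⟨v, hv, hv0, ⟨C, hC⟩, ε, hε, hε1, hω⟩ := hf.exists_normLE hR q.2
    have hs : shift 0 s ((X 0 : MvPowerSeries (Fin (n + 1)) F) ^ s -
        (q : MvPowerSeries (Fin (n + 1)) F) * (f : MvPowerSeries (Fin (n + 1)) F)) = 0 := by
      have h1 : (X 0 : MvPowerSeries (Fin (n + 1)) F) ^ s =
          (q : MvPowerSeries (Fin (n + 1)) F) * (f : MvPowerSeries (Fin (n + 1)) F) +
          (polyEmb P : MvPowerSeries (Fin (n + 1)) F) := by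
        exact congrArg Subtype.val h
      rw [h1, add_sub_cancel_left]
      exact shift_polyEmb_eq_zero hP
    obtain ⟨q', ⟨C', hq'⟩, h1⟩ := exists_mul_eq_one_of_shift_eq_zero hv0 hε hε1 hω hC hs
    refine IsUnit.of_mul_eq_one_right ⟨q', mem_overconv_of_normLE hR hv hq'⟩ (Subtype.ext h1)
  · rw [map_sub, hY, h]; ring

/-- Prime factors of a Weierstrass polynomial remain prime in the ring of power series: modulo
such a factor, Weierstrass division identifies series with polynomials. -/
theorem prime_polyEmb {s : ℕ} {f u : Overconv R (n + 1) F} (hR : 0 ≤ R)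
    (hf : IsRegular R s (f : MvPowerSeries (Fin (n + 1)) F))
    {ω : Polynomial (Overconv R n F)} (hω : ω.Monic) (hs : ω.degree = s) (hu : IsUnit u)
    (hωf : polyEmb ω = u * f) {π : Polynomial (Overconv R n F)} (hπ : Prime π) (hπω : π ∣ ω) :
    Prime (polyEmb π) := by
  -- Divisibility of a polynomial by `π` among series implies divisibility among polynomials.
  have hdvd : ∀ P : Polynomial (Overconv R n F), polyEmb π ∣ polyEmb P → π ∣ P := by
    rintro P ⟨h, hPh⟩
    obtain ⟨κ, rfl⟩ := hπω
    set Q := (P * κ) /ₘ (π * κ)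
    set ρ := (P * κ) %ₘ (π * κ)
    have hρ : ρ.degree < s := by
      rw [← hs]; exact Polynomial.degree_modByMonic_lt _ hω
    have hdiv : ρ + π * κ * Q = P * κ := Polynomial.modByMonic_add_div _ _
    have h1 : ((h - polyEmb Q) * u) * f = polyEmb ρ := by
      have h2 := congrArg polyEmb hdiv
      rw [map_add, map_mul _ (π * κ), hωf, map_mul, hPh] at h2
      have h3 := hωf
      rw [map_mul] at h3
      linear_combination -h2 - h * h3
    have h4 : (h - polyEmb Q) * u = 0 := by
      apply hf.eq_zero hR
      rw [h1]
      exact shift_polyEmb_eq_zero hρ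
    have h5 : h = polyEmb Q := by
      rw [hu.mul_left_eq_zero] at h4
      exact sub_eq_zero.mp h4
    refine ⟨Q, polyEmb_injective ?_⟩
    rw [hPh, h5, map_mul]
  have hrem : ∀ g : Overconv R (n + 1) F, ∃ P, polyEmb π ∣ g - polyEmb P := by
    intro g
    obtain ⟨q, P, -, h⟩ := hf.exists_div hR g
    refine ⟨P, ?_⟩
    rw [h, add_sub_cancel_right]
    have h1 : polyEmb π ∣ u * f := hωf ▸ map_dvd polyEmb hπω
    exact Dvd.dvd.mul_left ((hu.dvd_mul_left).mp h1) q
  refine ⟨?_, ?_, ?_⟩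
  · rw [map_ne_zero_iff _ polyEmb_injective]; exact hπ.ne_zero
  · intro h
    refine hπ.not_isUnit (isUnit_of_dvd_one (hdvd 1 ?_))
    rw [map_one]; exact h.dvd
  · intro a b hab
    obtain ⟨P, hP⟩ := hrem a
    obtain ⟨Q, hQ⟩ := hrem b
    have h1 : polyEmb π ∣ polyEmb (P * Q) := by
      rw [map_mul]
      have : polyEmb P * polyEmb Q = a * b - ((a - polyEmb P) * b + polyEmb P * (b - polyEmb Q)) := by
        ring
      rw [this]
      exact dvd_sub hab (dvd_add (hP.mul_right _) (hQ.mul_left _))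
    refine (hπ.dvd_or_dvd (hdvd _ h1)).imp (fun h => ?_) fun h => ?_
    · exact (dvd_iff_dvd_of_dvd_sub hP).mpr (map_dvd polyEmb h)
    · exact (dvd_iff_dvd_of_dvd_sub hQ).mpr (map_dvd polyEmb h)

theorem IsRegular.exists_prime_factors [UniqueFactorizationMonoid (Overconv R n F)] {s : ℕ}
    {f : Overconv R (n + 1) F} (hR : 0 ≤ R)
    (hf : IsRegular R s (f : MvPowerSeries (Fin (n + 1)) F)) :
    ∃ m : Multiset (Overconv R (n + 1) F), (∀ b ∈ m, Prime b) ∧ Associated m.prod f := by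
  obtain ⟨ω, hω, hs, u, hu, h⟩ := hf.exists_monic hR
  obtain ⟨m, hm, hmω⟩ := UniqueFactorizationMonoid.exists_prime_factors ω hω.ne_zero
  refine ⟨m.map polyEmb, ?_, ?_⟩
  · intro b hb
    obtain ⟨π, hπ, rfl⟩ := Multiset.mem_map.mp hb
    exact prime_polyEmb hR hf hω hs hu h (hm π hπ)
      ((Multiset.dvd_prod hπ).trans hmω.dvd)
  · rw [← map_multiset_prod]
    refine (hmω.map polyEmb).trans ?_
    rw [h]
    exact associated_unit_mul_left f u hu

end Preparation

/-! ### Generic points over the residue field -/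

section Residue

variable {F : Type*} [NormedField F] [IsUltrametricDist F]

/-- The closed unit ball of `F`, as a valuation subring. -/
abbrev unitBall (F : Type*) [NormedField F] [IsUltrametricDist F] : ValuationSubring F :=
  (NormedField.valuation (K := F)).valuationSubring

theorem norm_eq_one_of_isUnit {x : unitBall F} (hx : IsUnit x) : ‖(x : F)‖ = 1 := by
  obtain ⟨y, hy⟩ := hx.exists_right_inv
  have h1 : ‖(x : F)‖ * ‖(y : F)‖ = 1 := by
    rw [← norm_mul, ← norm_one (α := F)]
    exact congrArg _ (congrArg Subtype.val hy)
  have hx1 : ‖(x : F)‖ ≤ 1 := x.2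
  have hy1 : ‖(y : F)‖ ≤ 1 := y.2
  nlinarith [norm_nonneg (x : F), norm_nonneg (y : F)]

/-- The residue field is infinite: over a finite field with `q` elements `X ^ q - X - 1` has no
root, whereas an integral root exists in `F`. -/
theorem infinite_residueField [IsAlgClosed F] :
    Infinite (IsLocalRing.ResidueField (unitBall F)) := by
  by_contra hfin
  rw [not_infinite_iff_finite] at hfin
  let k := IsLocalRing.ResidueField (unitBall F)
  have : Fintype k := Fintype.ofFinite k
  set q := Fintype.card k
  have hq : 1 < q := Fintype.one_lt_card
  obtain ⟨x, hx⟩ := IsAlgClosed.exists_root (Polynomial.X ^ q - (Polynomial.X + 1) : Polynomial F)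
    (by
      rw [Polynomial.degree_sub_eq_left_of_degree_lt]
      · simp; omega
      · rw [Polynomial.degree_X_pow]
        refine (Polynomial.degree_add_le _ _).trans_lt (max_lt ?_ ?_)
        · rw [Polynomial.degree_X]; exact_mod_cast hq
        · rw [Polynomial.degree_one]; exact_mod_cast (by omega))
  have hx' : x ^ q = x + 1 := by
    simpa [sub_eq_zero] using hx
  have hx1 : ‖x‖ ≤ 1 := by
    by_contra! h
    have h1 : ‖x‖ ^ q ≤ ‖x‖ := by
      rw [← norm_pow, hx']
      refine (IsUltrametricDist.norm_add_le_max _ _).trans ?_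
      rw [norm_one]; exact max_le le_rfl h.le
    have h2 : ‖x‖ ^ 1 < ‖x‖ ^ q := pow_lt_pow_right₀ h hq
    rw [pow_one] at h2
    linarith
  let y : unitBall F := ⟨x, hx1⟩
  have hy : y ^ q = y + 1 := Subtype.ext hx'
  have h3 := congrArg (IsLocalRing.residue (unitBall F)) hy
  rw [map_pow, map_add, map_one, FiniteField.pow_card] at h3
  exact one_ne_zero (left_eq_add.mp h3)

/-- A polynomial attains its Gauss norm `A` at a point of the unit polydisc; the coordinate `x i`
may be required to have norm one. -/
theorem exists_norm_eval_eq [IsAlgClosed F] {σ : Type*} (i : σ) {P : MvPolynomial σ F}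
    {γ : σ →₀ ℕ} (hγ : P.coeff γ ≠ 0) (hP : ∀ δ, ‖P.coeff δ‖ ≤ ‖P.coeff γ‖) :
    ∃ x : σ → F, (∀ j, ‖x j‖ ≤ 1) ∧ ‖x i‖ = 1 ∧ ‖MvPolynomial.eval x P‖ = ‖P.coeff γ‖ := by
  have := infinite_residueField (F := F)
  obtain ⟨Q, hQ⟩ : (MvPolynomial.C (P.coeff γ)⁻¹ * P) ∈
      Set.range (MvPolynomial.map (σ := σ) (unitBall F).subtype) := by
    refine MvPolynomial.mem_range_map_iff_coeffs_subset.mpr ?_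
    intro c hc
    obtain ⟨δ, -, rfl⟩ := MvPolynomial.mem_coeffs_iff.mp hc
    refine ⟨⟨_, ?_⟩, rfl⟩
    change ‖MvPolynomial.coeff δ (MvPolynomial.C (P.coeff γ)⁻¹ * P)‖ ≤ 1
    rw [MvPolynomial.coeff_C_mul, norm_mul, norm_inv, inv_mul_le_iff₀
      (norm_pos_iff.mpr hγ), mul_one]
    exact hP δ
  have hQγ : Q.coeff γ = 1 := by
    have := congrArg (MvPolynomial.coeff γ) hQ
    rw [MvPolynomial.coeff_map, MvPolynomial.coeff_C_mul, inv_mul_cancel₀ hγ] at this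
    exact Subtype.ext this
  let Q' := MvPolynomial.map (IsLocalRing.residue (unitBall F)) Q
  have hQ' : Q' * MvPolynomial.X i ≠ 0 := by
    refine mul_ne_zero (fun h => ?_) (MvPolynomial.X_ne_zero i)
    have := congrArg (MvPolynomial.coeff γ) h
    rw [MvPolynomial.coeff_map, hQγ, map_one] at this
    exact one_ne_zero this
  obtain ⟨b, hb⟩ : ∃ b, MvPolynomial.eval b (Q' * MvPolynomial.X i) ≠ 0 := by
    by_contra! h
    exact hQ' (MvPolynomial.funext fun x => by rw [h x, map_zero])
  choose a ha using fun j => IsLocalRing.residue_surjective (b j)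
  have hab : b = fun j => IsLocalRing.residue (unitBall F) (a j) := funext fun j => (ha j).symm
  have heval : MvPolynomial.eval b Q' = IsLocalRing.residue _ (MvPolynomial.eval a Q) := by
    rw [hab, MvPolynomial.eval_map, ← MvPolynomial.eval₂_id, MvPolynomial.eval₂_comp_left]
    rfl
  rw [map_mul, MvPolynomial.eval_X, heval, ← ha i] at hb
  have hu1 := norm_eq_one_of_isUnit ((IsLocalRing.residue_ne_zero_iff_isUnit _).mp
    (left_ne_zero_of_mul hb))
  have hu2 := norm_eq_one_of_isUnit ((IsLocalRing.residue_ne_zero_iff_isUnit _).mp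
    (right_ne_zero_of_mul hb))
  refine ⟨fun j => a j, fun j => (a j).2, hu2, ?_⟩
  have h1 : MvPolynomial.eval (fun j => (a j : F)) (MvPolynomial.C (P.coeff γ)⁻¹ * P) =
      (MvPolynomial.eval a Q : F) := by
    rw [← hQ, MvPolynomial.eval_map]
    change _ = (unitBall F).subtype (MvPolynomial.eval a Q)
    rw [← MvPolynomial.eval₂_id, MvPolynomial.eval₂_comp_left]
    rfl
  rw [map_mul, MvPolynomial.eval_C] at h1
  rw [← h1, norm_mul, norm_inv, inv_mul_eq_one₀ (norm_ne_zero_iff.mpr hγ)] at hu1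
  exact hu1.symm

end Residue

/-! ### Linear changes of coordinates -/

section Shear

variable {F : Type*} [NormedField F] {n : ℕ}

/-- The substituted variables `X i + b i * X 0` of a linear change of coordinates. -/
def shearVar (b : Fin (n + 1) → F) (i : Fin (n + 1)) : MvPolynomial (Fin (n + 1)) F :=
  MvPolynomial.X i + MvPolynomial.C (b i) * MvPolynomial.X 0

theorem coe_shearVar (b : Fin (n + 1) → F) (i : Fin (n + 1)) :
    (shearVar b i : MvPowerSeries (Fin (n + 1)) F) = X i + C (b i) * X 0 := by
  simp only [shearVar, MvPolynomial.coe_add, MvPolynomial.coe_mul, MvPolynomial.coe_X,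
    MvPolynomial.coe_C]

theorem hasSubst_shear (b : Fin (n + 1) → F) :
    HasSubst fun i => (shearVar b i : MvPowerSeries (Fin (n + 1)) F) :=
  hasSubst_of_constantCoeff_zero fun i => by simp [shearVar]

/-- The image of the monomial with exponent `d` under the linear change of coordinates. -/
def shearMonomial (b : Fin (n + 1) → F) (d : Fin (n + 1) →₀ ℕ) : MvPolynomial (Fin (n + 1)) F :=
  ∏ i, shearVar b i ^ d i

theorem coe_shearMonomial (b : Fin (n + 1) → F) (d : Fin (n + 1) →₀ ℕ) :
    (shearMonomial b d : MvPowerSeries (Fin (n + 1)) F) =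
      ∏ i, (shearVar b i : MvPowerSeries (Fin (n + 1)) F) ^ d i := by
  rw [shearMonomial, ← MvPolynomial.coeToMvPowerSeries.ringHom_apply, map_prod]
  exact Finset.prod_congr rfl fun i _ => map_pow _ _ _

/-- The linear change of coordinates `X i ↦ X i + b i * X 0`. -/
def shear (b : Fin (n + 1) → F) :
    MvPowerSeries (Fin (n + 1)) F →ₐ[F] MvPowerSeries (Fin (n + 1)) F :=
  substAlgHom (hasSubst_shear b)

theorem coeff_shear (b : Fin (n + 1) → F) (f : MvPowerSeries (Fin (n + 1)) F)
    (γ : Fin (n + 1) →₀ ℕ) :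
    coeff γ (shear b f) = ∑ᶠ d, coeff d f * (shearMonomial b d).coeff γ := by
  rw [shear, substAlgHom_apply, coeff_subst (hasSubst_shear b)]
  refine finsum_congr fun d => ?_
  rw [smul_eq_mul, Finsupp.prod_fintype _ _ (by simp), ← MvPolynomial.coeff_coe,
    coe_shearMonomial]

theorem isHomogeneous_shearMonomial (b : Fin (n + 1) → F) (d : Fin (n + 1) →₀ ℕ) :
    (shearMonomial b d).IsHomogeneous d.degree := by
  rw [Finsupp.degree_eq_sum]
  refine MvPolynomial.IsHomogeneous.prod _ _ _ fun i _ => ?_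
  have : (shearVar b i).IsHomogeneous 1 :=
    (MvPolynomial.isHomogeneous_X _ _).add (MvPolynomial.isHomogeneous_C_mul_X _ _)
  simpa using this.pow (d i)

theorem coeff_shearMonomial_eq_zero (b : Fin (n + 1) → F) {d γ : Fin (n + 1) →₀ ℕ}
    (h : d.degree ≠ γ.degree) : (shearMonomial b d).coeff γ = 0 :=
  (isHomogeneous_shearMonomial b d).coeff_eq_zero h.symm

theorem shear_shear_neg {b : Fin (n + 1) → F} (hb : b 0 = 0) (f : MvPowerSeries (Fin (n + 1)) F) :
    shear (-b) (shear b f) = f := by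
  rw [shear, shear, substAlgHom_comp_substAlgHom_apply, substAlgHom_apply]
  have : (fun s => substAlgHom (hasSubst_shear (-b))
      (shearVar b s : MvPowerSeries (Fin (n + 1)) F)) = X := by
    funext i
    rw [substAlgHom_coe]
    simp only [shearVar, map_add, map_mul, MvPolynomial.aeval_X, MvPolynomial.aeval_C]
    rw [← shearVar, ← shearVar, coe_shearVar, coe_shearVar, ← c_eq_algebraMap]
    simp [hb]
  rw [this, subst_self]
  rfl

theorem finite_setOf_degree_eq (k : ℕ) : {d : Fin n →₀ ℕ | d.degree = k}.Finite :=
  (Finsupp.finite_of_degree_le k).subset fun _ hd => le_of_eq hd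

/-- The homogeneous component of degree `k` of a power series. -/
def homogPart (k : ℕ) (f : MvPowerSeries (Fin n) F) : MvPolynomial (Fin n) F :=
  ∑ d ∈ (finite_setOf_degree_eq (n := n) k).toFinset, MvPolynomial.monomial d (coeff d f)

theorem coeff_homogPart (k : ℕ) (f : MvPowerSeries (Fin n) F) (γ : Fin n →₀ ℕ) :
    (homogPart k f).coeff γ = if γ.degree = k then coeff γ f else 0 := by
  classical
  simp [homogPart, MvPolynomial.coeff_sum, MvPolynomial.coeff_monomial]

/-- The coefficient of `X 0 ^ k` after a linear change of coordinates is a value of the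
homogeneous component of degree `k`. -/
theorem coeff_single_shear {b : Fin (n + 1) → F} (k : ℕ)
    (f : MvPowerSeries (Fin (n + 1)) F) :
    coeff (Finsupp.single 0 k) (shear b f) =
      MvPolynomial.eval (Pi.single 0 1 + b) (homogPart k f) := by
  classical
  have hcoeff : ∀ Q : MvPolynomial (Fin (n + 1)) F, Q.IsHomogeneous k →
      Q.coeff (Finsupp.single 0 k) = MvPolynomial.eval (Pi.single 0 1) Q := by
    intro Q hQ
    rw [MvPolynomial.eval_eq']
    rw [Finset.sum_eq_single (Finsupp.single 0 k)]
    · rw [Finset.prod_eq_one, mul_one]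
      intro i _
      by_cases hi : i = 0
      · simp [hi]
      · simp [Ne.symm hi]
    · intro d hd hdk
      have hdeg : d.degree = k := by
        by_contra h
        exact (MvPolynomial.mem_support_iff.mp hd) (hQ.coeff_eq_zero h)
      obtain ⟨i, hi, hdi⟩ : ∃ i : Fin (n + 1), i ≠ 0 ∧ d i ≠ 0 := by
        by_contra! h
        apply hdk
        have hd0 : d = Finsupp.single 0 (d 0) := by
          ext i
          by_cases hi : i = 0
          · simp [hi]
          · simp [Ne.symm hi, h i hi]
        rw [hd0, Finsupp.degree_single] at hdeg
        rw [hd0, hdeg]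
      rw [Finset.prod_eq_zero (Finset.mem_univ i), mul_zero]
      simp [hi, hdi]
    · intro h
      rw [MvPolynomial.notMem_support_iff.mp h, zero_mul]
  rw [coeff_shear, finsum_eq_sum_of_support_subset (s := (finite_setOf_degree_eq k).toFinset)]
  · rw [homogPart, map_sum]
    refine Finset.sum_congr rfl fun d hd => ?_
    have hd' : d.degree = k := by simpa using hd
    rw [MvPolynomial.eval_monomial, Finsupp.prod_fintype _ _ (by simp),
      hcoeff _ (hd' ▸ isHomogeneous_shearMonomial b d), shearMonomial, map_prod]
    simp [shearVar]
  · intro d hd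
    rw [Function.mem_support] at hd
    by_contra h
    refine hd ?_
    rw [coeff_shearMonomial_eq_zero, mul_zero]
    simpa using h

variable [IsUltrametricDist F]

theorem norm_coeff_shearMonomial_le {b : Fin (n + 1) → F} (hb : ∀ i, ‖b i‖ ≤ 1)
    (d γ : Fin (n + 1) →₀ ℕ) : ‖(shearMonomial b d).coeff γ‖ ≤ 1 := by
  have h1 : ∀ _ : Fin (n + 1), (0 : ℝ) < 1 := fun _ => one_pos
  have hvar : ∀ i, NormLE (fun _ => 1) 1 (shearVar b i : MvPowerSeries (Fin (n + 1)) F) := by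
    intro i
    have hX : ∀ j, NormLE (fun _ => 1) 1 (X j : MvPowerSeries (Fin (n + 1)) F) := fun j => by
      simpa using normLE_X_pow (F := F) h1 j 1
    have hC : NormLE (fun _ => 1) 1 (C (b i) : MvPowerSeries (Fin (n + 1)) F) := by
      rw [← monomial_zero_eq_C_apply]
      exact (normLE_monomial h1 0 (b i)).mono (by rw [wt_zero, mul_one]; exact hb i)
    have h := (hX i).add h1 ((hC.mul h1 (hX 0)).mono (by norm_num))
    simpa [shearVar] using h
  have hprod : NormLE (fun _ => 1) 1 (∏ i, (shearVar b i : MvPowerSeries (Fin (n + 1)) F) ^ d i) := by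
    refine Finset.prod_induction _ (NormLE (fun _ => 1) 1)
      (fun f g hf hg => (hf.mul h1 hg).mono (by norm_num)) (normLE_one h1) fun i _ => ?_
    induction d i with
    | zero => simpa using normLE_one h1
    | succ k ih =>
      rw [pow_succ]
      exact (ih.mul h1 (hvar i)).mono (by norm_num)
  have := hprod γ
  rw [wt_const, one_pow, mul_one] at this
  rwa [← MvPolynomial.coeff_coe, coe_shearMonomial]

/-- A linear change of coordinates preserves bounds depending only on the total degree. -/
theorem norm_coeff_shear_le {b : Fin (n + 1) → F} (hb : ∀ i, ‖b i‖ ≤ 1)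
    {f : MvPowerSeries (Fin (n + 1)) F} {B : ℕ → ℝ} (hf : ∀ d, ‖coeff d f‖ ≤ B d.degree)
    (γ : Fin (n + 1) →₀ ℕ) : ‖coeff γ (shear b f)‖ ≤ B γ.degree := by
  rw [coeff_shear, finsum_eq_sum_of_support_subset
    (s := (finite_setOf_degree_eq γ.degree).toFinset)]
  · refine IsUltrametricDist.norm_sum_le_of_forall_le_of_nonneg
      ((norm_nonneg _).trans (hf γ)) fun d hd => ?_
    have hd' : d.degree = γ.degree := by simpa using hd
    rw [norm_mul, ← hd', ← mul_one (B d.degree)]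
    exact mul_le_mul (hf d) (norm_coeff_shearMonomial_le hb d γ) (norm_nonneg _)
      ((norm_nonneg _).trans (hf d))
  · intro d hd
    rw [Function.mem_support] at hd
    by_contra h
    refine hd ?_
    rw [coeff_shearMonomial_eq_zero, mul_zero]
    simpa using h

theorem shear_mem_overconv {R : ℝ} {b : Fin (n + 1) → F} (hb : ∀ i, ‖b i‖ ≤ 1)
    {f : MvPowerSeries (Fin (n + 1)) F} (hf : f ∈ Overconv R (n + 1) F) :
    shear b f ∈ Overconv R (n + 1) F := by
  obtain ⟨ρ, hρ, hρ0, C, hC⟩ := mem_overconv_iff.mp hf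
  refine ⟨ρ, hρ, hρ0, C, fun γ => ?_⟩
  rw [wt_const, ← le_div_iff₀ (pow_pos hρ0 _)]
  refine norm_coeff_shear_le (B := fun k => C / ρ ^ k) hb (fun d => ?_) γ
  rw [le_div_iff₀ (pow_pos hρ0 _), ← wt_const]
  exact hC d

/-- A linear change of coordinates as an automorphism of the ring of overconvergent series. -/
def shearEquiv (R : ℝ) {b : Fin (n + 1) → F} (hb : ∀ i, ‖b i‖ ≤ 1) (hb0 : b 0 = 0) :
    Overconv R (n + 1) F ≃* Overconv R (n + 1) F where
  toFun f := ⟨shear b f, shear_mem_overconv hb f.2⟩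
  invFun f := ⟨shear (-b) f, shear_mem_overconv (by simpa using hb) f.2⟩
  left_inv f := Subtype.ext (shear_shear_neg hb0 _)
  right_inv f := Subtype.ext (by
    have := shear_shear_neg (b := -b) (by simpa using hb0) (f : MvPowerSeries (Fin (n + 1)) F)
    rwa [neg_neg] at this)
  map_mul' f g := Subtype.ext (map_mul (shear b) _ _)

end Shear

/-! ### Unique factorization for overconvergent series -/

section Factorial

variable {F : Type*} [NormedField F] {n : ℕ}

theorem tendsto_pow_degree_cofinite {q : ℝ} (hq : 0 ≤ q) (hq1 : q < 1) :
    Tendsto (fun γ : Fin n →₀ ℕ => q ^ γ.degree) cofinite (𝓝 0) := by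
  have h : Tendsto (fun γ : Fin n →₀ ℕ => γ.degree) cofinite atTop := by
    rw [← Nat.cofinite_eq_atTop]
    refine Tendsto.cofinite_of_finite_preimage_singleton fun k => finite_setOf_degree_eq k
  exact (tendsto_pow_atTop_nhds_zero_of_lt_one hq hq1).comp h

theorem NormLE.tendsto_of_lt {r ρ C : ℝ} (hr : 0 < r) (h : r < ρ) {f : MvPowerSeries (Fin n) F}
    (hf : NormLE (fun _ => ρ) C f) :
    Tendsto (fun γ => ‖coeff γ f‖ * r ^ γ.degree) cofinite (𝓝 0) := by
  have hρ : 0 < ρ := hr.trans h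
  have ht := (tendsto_pow_degree_cofinite (n := n) (div_pos hr hρ).le
    ((div_lt_one hρ).mpr h)).const_mul C
  rw [mul_zero] at ht
  refine squeeze_zero (fun γ => by positivity) (fun γ => ?_) ht
  have h1 := hf γ
  rw [wt_const] at h1
  calc ‖coeff γ f‖ * r ^ γ.degree = (‖coeff γ f‖ * ρ ^ γ.degree) * (r / ρ) ^ γ.degree := by
        rw [div_pow]; field_simp
    _ ≤ C * (r / ρ) ^ γ.degree := mul_le_mul_of_nonneg_right h1 (by positivity)

/-- A function tending to zero that is positive somewhere has a maximum, and `d` can be maximized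
among its maximizers. -/
theorem exists_max_of_tendsto_zero {ι α : Type*} [LinearOrder α] {φ : ι → ℝ} (d : ι → α)
    (hφ : Tendsto φ cofinite (𝓝 0)) {i₀ : ι} (hi₀ : 0 < φ i₀) :
    ∃ i, 0 < φ i ∧ (∀ j, φ j ≤ φ i) ∧ ∀ j, d i < d j → φ j < φ i := by
  have hfin : {i | φ i₀ ≤ φ i}.Finite := by
    have := hφ.eventually_lt_const hi₀
    rw [eventually_cofinite] at this
    simpa using this
  obtain ⟨i, hi, hmax⟩ := Finset.exists_max_image hfin.toFinset (fun i => toLex (φ i, d i))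
    ⟨i₀, by simp⟩
  rw [Set.Finite.mem_toFinset] at hi
  have hle : ∀ j, toLex (φ j, d j) ≤ toLex (φ i, d i) ∨ φ j < φ i := by
    intro j
    by_cases hj : φ i₀ ≤ φ j
    · exact Or.inl (hmax j (by simpa using hj))
    · exact Or.inr ((not_le.mp hj).trans_le hi)
  refine ⟨i, hi₀.trans_le hi, fun j => ?_, fun j hij => ?_⟩
  · rcases hle j with h | h
    · rw [Prod.Lex.toLex_le_toLex] at h
      rcases h with h | h
      exacts [h.le, h.1.le]
    · exact h.le
  · rcases hle j with h | h
    · rw [Prod.Lex.toLex_le_toLex] at h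
      rcases h with h | h
      exacts [h, absurd h.2 (not_le.mpr hij)]
    · exact h

/-- Among the monomials dominating `f` on the polydisc of radius `R` there is one of largest
degree; terms of larger degree stay smaller on a slightly larger polydisc. -/
theorem exists_dominant_monomial {R : ℝ} (hR : 0 < R) {f : MvPowerSeries (Fin n) F}
    (hf : ∃ ρ : ℝ, R < ρ ∧ 0 < ρ ∧ ∃ C, NormLE (fun _ => ρ) C f) (hf0 : f ≠ 0) :
    ∃ γ, coeff γ f ≠ 0 ∧
      (∀ δ, ‖coeff δ f‖ * R ^ δ.degree ≤ ‖coeff γ f‖ * R ^ γ.degree) ∧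
      ∃ ρ, R < ρ ∧ ∀ δ, γ.degree < δ.degree →
        ‖coeff δ f‖ * ρ ^ δ.degree ≤ ‖coeff γ f‖ * ρ ^ γ.degree := by
  obtain ⟨ρ₁, hρ₁, -, C, hC⟩ := hf
  obtain ⟨γ₀, hγ₀⟩ := (MvPowerSeries.ne_zero_iff_exists_coeff_ne_zero f).mp hf0
  obtain ⟨γ, hγ, hmax, hlt⟩ := exists_max_of_tendsto_zero (fun δ => δ.degree)
    (hC.tendsto_of_lt hR hρ₁) (i₀ := γ₀) (by positivity)
  refine ⟨γ, fun h => by simp [h] at hγ, hmax, ?_⟩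
  -- Beyond a finite set the terms are already small at an intermediate radius.
  have hfin := (hC.tendsto_of_lt (r := (R + ρ₁) / 2) (by linarith) (by linarith)).eventually_lt_const
    hγ
  rw [eventually_cofinite] at hfin
  have hev : ∀ᶠ r in 𝓝 R, ∀ δ ∈ {δ : Fin n →₀ ℕ | ¬ ‖coeff δ f‖ * ((R + ρ₁) / 2) ^ δ.degree <
      ‖coeff γ f‖ * R ^ γ.degree}, γ.degree < δ.degree →
      ‖coeff δ f‖ * r ^ δ.degree < ‖coeff γ f‖ * r ^ γ.degree := by
    rw [hfin.eventually_all]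
    intro δ _
    rw [eventually_imp_distrib_left]
    intro hδ
    exact (continuous_const.mul (continuous_pow _)).continuousAt.eventually_lt
      (continuous_const.mul (continuous_pow _)).continuousAt (hlt δ hδ)
  have hev2 : ∀ᶠ r in 𝓝[>] R, r < (R + ρ₁) / 2 :=
    nhdsWithin_le_nhds (eventually_lt_nhds (by linarith))
  obtain ⟨ρ, ⟨hρ, hρ'⟩, hRρ⟩ := (((hev.filter_mono nhdsWithin_le_nhds).and hev2).and
    (eventually_mem_nhdsWithin (s := Set.Ioi R))).exists
  have hRρ : R < ρ := hRρ
  refine ⟨ρ, hRρ, fun δ hδ => ?_⟩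
  by_cases hmem : ‖coeff δ f‖ * ((R + ρ₁) / 2) ^ δ.degree < ‖coeff γ f‖ * R ^ γ.degree
  · calc ‖coeff δ f‖ * ρ ^ δ.degree ≤ ‖coeff δ f‖ * ((R + ρ₁) / 2) ^ δ.degree := by
          have := hR.trans hRρ
          gcongr
      _ ≤ ‖coeff γ f‖ * R ^ γ.degree := hmem.le
      _ ≤ ‖coeff γ f‖ * ρ ^ γ.degree := by gcongr
  · exact (hρ δ hmem hδ).le

theorem degree_cons (k : ℕ) (x : Fin n →₀ ℕ) : (x.cons k).degree = k + x.degree := by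
  simp [Finsupp.degree_eq_sum, Fin.sum_univ_succ]

theorem eval_homogPart_mul (k : ℕ) (f : MvPowerSeries (Fin n) F) (c : F) (x : Fin n → F) :
    MvPolynomial.eval (fun i => c * x i) (homogPart k f) =
      c ^ k * MvPolynomial.eval x (homogPart k f) := by
  rw [homogPart, map_sum, map_sum, Finset.mul_sum]
  refine Finset.sum_congr rfl fun d hd => ?_
  have hd' : d.degree = k := by simpa using hd
  rw [MvPolynomial.eval_monomial, MvPolynomial.eval_monomial, Finsupp.prod_fintype _ _ (by simp),
    Finsupp.prod_fintype _ _ (by simp), ← hd', Finsupp.degree_eq_sum, ← Finset.prod_pow_eq_pow_sum]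
  simp only [mul_pow, Finset.prod_mul_distrib]
  ring

/-- Bounds by the monomial `X 0 ^ s` in terms of the total degree imply regularity: for polyradii
slightly larger in the direction of `X 0` this monomial strictly dominates all others. -/
theorem isRegular_of_le {R ρ : ℝ} (hR : 0 < R) (hρ : R < ρ) {s : ℕ}
    {f : MvPowerSeries (Fin (n + 1)) F} (hs : coeff (Finsupp.single 0 s) f = 1)
    (hle : ∀ δ, δ.degree ≤ s → ‖coeff δ f‖ * R ^ δ.degree ≤ R ^ s)
    (hgt : ∀ δ, s < δ.degree → ‖coeff δ f‖ * ρ ^ δ.degree ≤ ρ ^ s) : IsRegular R s f := by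
  classical
  intro τ hτ
  obtain ⟨r₁, hRr₁, hr₁⟩ := exists_between (lt_min hτ hρ)
  obtain ⟨hr₁τ, hr₁ρ⟩ := lt_min_iff.mp hr₁
  obtain ⟨r₂, hRr₂, hr₂⟩ := exists_between hRr₁
  have h1 : 0 < r₁ := hR.trans hRr₁
  have h2 : 0 < r₂ := hR.trans hRr₂
  have h3 : 0 < ρ := hR.trans hρ
  let v : Fin (n + 1) → ℝ := Fin.cons r₁ fun _ => r₂
  have hv0 : v 0 = r₁ := rfl
  have hvs : ∀ i : Fin n, v i.succ = r₂ := fun i => rfl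
  have hvle : ∀ i, v i ≤ r₁ := Fin.cases le_rfl fun i => hr₂.le
  have hvpos : ∀ i, 0 < v i := Fin.cases h1 fun i => h2
  refine ⟨v, fun i => ⟨?_, (hvle i).trans hr₁τ.le⟩, max (r₁ / ρ) (r₂ / r₁), by positivity,
    max_lt ((div_lt_one h3).mpr hr₁ρ) ((div_lt_one h1).mpr hr₂), fun δ => ?_⟩
  · exact Fin.cases (motive := fun i => R < v i) hRr₁ (fun _ => hRr₂) i
  rw [hv0]
  have hr₁s : 0 < r₁ ^ s := by positivity
  by_cases hδ : δ = Finsupp.single 0 s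
  · rw [map_sub, hδ, hs, coeff_X_pow, if_pos rfl, sub_self, norm_zero, zero_mul]
    positivity
  rw [map_sub, coeff_X_pow, if_neg hδ, sub_zero]
  rcases le_or_gt δ.degree s with hd | hd
  · refine le_trans ?_ (mul_le_mul_of_nonneg_right (le_max_right _ _) hr₁s.le)
    obtain ⟨k, x, rfl⟩ : ∃ k x, δ = Finsupp.cons k x := ⟨δ 0, δ.tail, (Finsupp.cons_tail δ).symm⟩
    have hk : k < s := by
      rw [degree_cons] at hd
      by_contra! hks
      apply hδ
      have hx : x = 0 := by
        rw [← Finsupp.degree_eq_zero_iff]; omega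
      have hks' : k = s := by omega
      subst hx hks'
      ext i
      refine Fin.cases ?_ (fun i => ?_) i <;> simp
    rw [wt_cons, hv0]
    simp only [hvs, wt_const]
    have h4 := hle _ hd
    rw [degree_cons] at h4 hd
    obtain ⟨e, rfl⟩ : ∃ e, s = k + x.degree + e := ⟨s - (k + x.degree), by omega⟩
    have h5 : ‖coeff (Finsupp.cons k x) f‖ ≤ R ^ e := by
      rw [pow_add R (k + x.degree) e, mul_comm] at h4
      exact le_of_mul_le_mul_left h4 (by positivity)
    obtain ⟨t, ht⟩ : ∃ t, x.degree + e = t + 1 := ⟨x.degree + e - 1, by omega⟩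
    calc ‖coeff (Finsupp.cons k x) f‖ * (r₁ ^ k * r₂ ^ x.degree)
        ≤ r₂ ^ e * (r₁ ^ k * r₂ ^ x.degree) := by
          refine mul_le_mul_of_nonneg_right (h5.trans ?_) (by positivity)
          gcongr
      _ = r₁ ^ k * r₂ ^ t * r₂ := by
          rw [mul_assoc, ← pow_succ, ← ht, pow_add]; ring
      _ ≤ r₁ ^ k * r₁ ^ t * r₂ := by gcongr
      _ = r₂ / r₁ * r₁ ^ (k + x.degree + e) := by
          rw [add_assoc, ht, pow_add, pow_succ]; field_simp
  · refine le_trans ?_ (mul_le_mul_of_nonneg_right (le_max_left _ _) hr₁s.le)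
    obtain ⟨e, he⟩ : ∃ e, δ.degree = s + e + 1 := ⟨δ.degree - s - 1, by omega⟩
    have h4 := hgt δ hd
    have h5 : wt v δ ≤ r₁ ^ δ.degree := (wt_le_wt hvpos hvle δ).trans (wt_const r₁ δ).le
    rw [he] at h4 h5
    have h6 : ‖coeff δ f‖ * ρ ^ (e + 1) ≤ 1 := by
      rw [add_assoc, pow_add] at h4
      have : ‖coeff δ f‖ * ρ ^ (e + 1) * ρ ^ s ≤ 1 * ρ ^ s := by linarith
      exact le_of_mul_le_mul_right this (by positivity)
    calc ‖coeff δ f‖ * wt v δ ≤ ‖coeff δ f‖ * r₁ ^ (s + e + 1) := by gcongr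
      _ = ‖coeff δ f‖ * r₁ ^ (e + 1) * r₁ ^ s := by ring
      _ = (‖coeff δ f‖ * ρ ^ (e + 1)) * (r₁ / ρ) ^ (e + 1) * r₁ ^ s := by
          rw [div_pow]; field_simp
      _ ≤ 1 * (r₁ / ρ) ^ 1 * r₁ ^ s := by
          gcongr ?_ * ?_ * _
          exact pow_le_pow_of_le_one (by positivity) ((div_lt_one h3).mpr hr₁ρ).le (by omega)
      _ = r₁ / ρ * r₁ ^ s := by ring

variable [IsUltrametricDist F]

/-- After a linear change of coordinates and multiplication by a constant, every nonzero
overconvergent series is regular. -/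
theorem exists_shear_isRegular [IsAlgClosed F] {R : ℝ} (hR : 0 < R)
    {f : MvPowerSeries (Fin (n + 1)) F} (hf : f ∈ Overconv R (n + 1) F) (hf0 : f ≠ 0) :
    ∃ b : Fin (n + 1) → F, (∀ i, ‖b i‖ ≤ 1) ∧ b 0 = 0 ∧ ∃ κ : F, κ ≠ 0 ∧ ∃ s,
      IsRegular R s (C κ * shear b f) := by
  classical
  obtain ⟨γ, hγ, hmax, ρ, hρ, hgt⟩ := exists_dominant_monomial hR (mem_overconv_iff.mp hf) hf0
  set s := γ.degree
  set A := ‖coeff γ f‖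
  have hA : 0 < A := norm_pos_iff.mpr hγ
  have hγP : (homogPart s f).coeff γ = coeff γ f := by rw [coeff_homogPart, if_pos rfl]
  obtain ⟨x, hx, hx0, hev⟩ := exists_norm_eval_eq (P := homogPart s f) (γ := γ) 0
    (by rwa [hγP]) (fun δ => by
      rw [hγP, coeff_homogPart]
      split_ifs with h
      · have := hmax δ
        rw [h] at this
        exact le_of_mul_le_mul_right this (by positivity)
      · simp)
  rw [hγP] at hev
  have hx00 : x 0 ≠ 0 := norm_ne_zero_iff.mp (by rw [hx0]; exact one_ne_zero)
  let b : Fin (n + 1) → F := fun i => (x 0)⁻¹ * x i - Pi.single (M := fun _ => F) 0 1 i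
  have hb0 : b 0 = 0 := by simp [b, hx00]
  have hb : ∀ i, ‖b i‖ ≤ 1 := by
    intro i
    by_cases hi : i = 0
    · rw [hi, hb0, norm_zero]; exact zero_le_one
    · simp [b, hi, hx0, hx i]
  have heval : ‖coeff (Finsupp.single 0 s) (shear b f)‖ = A := by
    have h1 : (Pi.single 0 1 + b : Fin (n + 1) → F) = fun i => (x 0)⁻¹ * x i := by
      funext i; simp [b]
    rw [coeff_single_shear, h1, eval_homogPart_mul, norm_mul, norm_pow, norm_inv, hx0, hev]
    simp [A]
  have hne : coeff (Finsupp.single 0 s) (shear b f) ≠ 0 := norm_ne_zero_iff.mp (by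
    rw [heval]; exact hA.ne')
  refine ⟨b, hb, hb0, (coeff (Finsupp.single 0 s) (shear b f))⁻¹, inv_ne_zero hne, s, ?_⟩
  have hbound := norm_coeff_shear_le hb (f := f)
    (B := fun k => if k ≤ s then A * R ^ s / R ^ k else A * ρ ^ s / ρ ^ k) (fun d => by
      split_ifs with h
      · rw [le_div_iff₀ (by positivity)]; exact hmax d
      · rw [le_div_iff₀ (pow_pos (hR.trans hρ) _)]; exact hgt d (not_le.mp h))
  refine isRegular_of_le hR hρ ?_ (fun δ hδ => ?_) fun δ hδ => ?_
  · rw [coeff_C_mul, inv_mul_cancel₀ hne]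
  · have := hbound δ
    rw [if_pos hδ, le_div_iff₀ (by positivity)] at this
    rw [coeff_C_mul, norm_mul, norm_inv, heval, mul_assoc, inv_mul_le_iff₀ hA]
    exact this
  · have := hbound δ
    rw [if_neg (not_le.mpr hδ), le_div_iff₀ (pow_pos (hR.trans hρ) _)] at this
    rw [coeff_C_mul, norm_mul, norm_inv, heval, mul_assoc, inv_mul_le_iff₀ hA]
    exact this

variable (n F) in
/-- The overconvergent power series on a polydisc form a unique factorization domain. -/
theorem uniqueFactorizationMonoid_overconv [IsAlgClosed F] [CompleteSpace F] {R : ℝ}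
    (hR : 0 < R) : UniqueFactorizationMonoid (Overconv R n F) := by
  have hC : ∀ (n : ℕ) {κ : F}, κ ≠ 0 → ∃ u : Overconv R n F, IsUnit u ∧
      (u : MvPowerSeries (Fin n) F) = C κ := by
    intro n κ hκ
    refine ⟨⟨C κ, monomial_mem_overconv 0 κ⟩, ?_, rfl⟩
    refine IsUnit.of_mul_eq_one ⟨C κ⁻¹, monomial_mem_overconv 0 κ⁻¹⟩ (Subtype.ext ?_)
    change C κ * C κ⁻¹ = 1
    rw [← map_mul, mul_inv_cancel₀ hκ, map_one]
  induction n with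
  | zero =>
    refine UniqueFactorizationMonoid.of_exists_prime_factors fun f hf => ⟨0, by simp, ?_⟩
    rw [Multiset.prod_zero]
    obtain ⟨κ, hκ⟩ := MvPowerSeries.C_surjective (f : MvPowerSeries (Fin 0) F)
    have hκ0 : κ ≠ 0 := by
      rintro rfl
      exact hf (Subtype.ext (by rw [← hκ, map_zero]; rfl))
    obtain ⟨u, hu, huκ⟩ := hC 0 hκ0
    have : u = f := Subtype.ext (huκ.trans hκ)
    exact (associated_one_iff_isUnit.mpr (this ▸ hu)).symm
  | succ n ih =>
    refine UniqueFactorizationMonoid.of_exists_prime_factors fun f hf => ?_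
    obtain ⟨b, hb, hb0, κ, hκ, s, hreg⟩ := exists_shear_isRegular hR f.2
      (fun h => hf (Subtype.ext h))
    obtain ⟨u, hu, huκ⟩ := hC (n + 1) hκ
    let e := shearEquiv R hb hb0
    have hreg' : IsRegular R s ((u * e f : Overconv R (n + 1) F) :
        MvPowerSeries (Fin (n + 1)) F) := by
      rw [Subring.coe_mul, huκ]; exact hreg
    obtain ⟨m, hm, hmf⟩ := hreg'.exists_prime_factors hR.le
    refine ⟨m.map e.symm, ?_, ?_⟩
    · intro p hp
      obtain ⟨q, hq, rfl⟩ := Multiset.mem_map.mp hp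
      exact (MulEquiv.prime_iff e.symm).mpr (hm q hq)
    · have h1 := (hmf.trans (associated_unit_mul_left (e f) u hu)).map e.symm
      rw [map_multiset_prod, MulEquiv.symm_apply_apply] at h1
      exact h1

end Factorial

/-! ### Multiplicativity of the Gauss norm -/

section Multiplicative

variable {F : Type*} [NormedField F] {n : ℕ} {r : ℝ}
  {f g : MvPowerSeries (Fin n) F}

theorem NormLE.gaussNorm_le {C : ℝ} {h : MvPowerSeries (Fin n) F}
    (hh : NormLE (fun _ => r) C h) : gaussNorm (fun a : F => ‖a‖) (fun _ => r) h ≤ C :=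
  ciSup_le fun γ => hh γ

theorem NormLE.normLE_gaussNorm {C : ℝ} {h : MvPowerSeries (Fin n) F}
    (hh : NormLE (fun _ => r) C h) :
    NormLE (fun _ => r) (gaussNorm (fun a : F => ‖a‖) (fun _ => r) h) h :=
  fun γ => le_gaussNorm (fun a : F => ‖a‖) (fun _ => r) h
    ⟨C, by rintro _ ⟨δ, rfl⟩; exact hh δ⟩ γ

variable [IsUltrametricDist F]

/-- The Gauss norm is multiplicative on series whose terms tend to zero: the coefficient of the
product at the sum of the lexicographically largest dominant exponents has no cancellation. -/
theorem gaussNorm_mul_of_tendsto (hr : 0 < r)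
    (hf : Tendsto (fun γ => ‖coeff γ f‖ * r ^ γ.degree) cofinite (𝓝 0))
    (hg : Tendsto (fun γ => ‖coeff γ g‖ * r ^ γ.degree) cofinite (𝓝 0)) :
    gaussNorm (fun a : F => ‖a‖) (fun _ => r) (f * g) =
      gaussNorm (fun a : F => ‖a‖) (fun _ => r) f * gaussNorm (fun a : F => ‖a‖) (fun _ => r) g := by
  classical
  by_cases hf0 : f = 0
  · simp [hf0, gaussNorm_zero]
  by_cases hg0 : g = 0
  · simp [hg0, gaussNorm_zero]
  have hwt : ∀ γ : Fin n →₀ ℕ, (γ.prod fun _ k => r ^ k) = r ^ γ.degree := fun γ => wt_const r γ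
  have key : ∀ h : MvPowerSeries (Fin n) F, h ≠ 0 →
      Tendsto (fun γ => ‖coeff γ h‖ * r ^ γ.degree) cofinite (𝓝 0) →
      ∃ i, (∀ j, ‖coeff j h‖ * r ^ j.degree ≤ ‖coeff i h‖ * r ^ i.degree) ∧
        (∀ j, toLex i < toLex j → ‖coeff j h‖ * r ^ j.degree < ‖coeff i h‖ * r ^ i.degree) := by
    intro h h0 ht
    obtain ⟨γ, hγ⟩ := (MvPowerSeries.ne_zero_iff_exists_coeff_ne_zero h).mp h0
    obtain ⟨i, -, hi⟩ := exists_max_of_tendsto_zero (fun γ => toLex γ) ht (i₀ := γ) (by positivity)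
    exact ⟨i, hi⟩
  obtain ⟨i, hi, hi'⟩ := key f hf0 hf
  obtain ⟨j, hj, hj'⟩ := key g hg0 hg
  have bdd : ∀ (h : MvPowerSeries (Fin n) F) (C : ℝ), (∀ γ, ‖coeff γ h‖ * r ^ γ.degree ≤ C) →
      HasGaussNorm (fun a : F => ‖a‖) (fun _ => r) h := by
    rintro h C hC
    refine ⟨C, ?_⟩
    rintro _ ⟨γ, rfl⟩
    simp only [hwt]
    exact hC γ
  have ach : ∀ (h : MvPowerSeries (Fin n) F) (i),
      (∀ j, ‖coeff j h‖ * r ^ j.degree ≤ ‖coeff i h‖ * r ^ i.degree) →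
      AchievesGaussNorm (fun a : F => ‖a‖) (fun _ => r) h i := by
    intro h i hi
    refine le_antisymm (le_gaussNorm _ _ _ (bdd h _ hi) i) (ciSup_le fun j => ?_)
    simp only [hwt]
    exact hi j
  have hfg : NormLE (fun _ => r) (‖coeff i f‖ * r ^ i.degree * (‖coeff j g‖ * r ^ j.degree))
      (f * g) := by
    refine NormLE.mul (fun _ => hr) (fun γ => ?_) fun γ => ?_ <;> rw [wt_const]
    exacts [hi γ, hj γ]
  refine gaussNorm_mul_eq_mul _ _ f g (bdd f _ hi) (bdd g _ hj)
    (bdd (f * g) _ fun γ => by rw [← wt_const]; exact hfg γ) norm_nonneg norm_zero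
    IsUltrametricDist.isNonarchimedean_norm norm_mul norm_neg (fun x hx => norm_eq_zero.mp hx)
    (fun _ => hr) ⟨i, j, ach f i hi, ach g j hj, ?_⟩
  intro p hp hne
  rw [Finset.HasAntidiagonal.mem_antidiagonal] at hp
  have hcase : toLex i < toLex p.1 ∨ toLex j < toLex p.2 := by
    by_contra! h
    have hp' : toLex p.1 + toLex p.2 = toLex i + toLex j := congrArg toLex hp
    have h1 : toLex p.1 = toLex i := by
      refine le_antisymm h.1 ?_
      by_contra! hlt
      exact absurd hp' (add_lt_add_of_lt_of_le hlt h.2).ne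
    have h2 : toLex p.2 = toLex j := by
      rw [h1] at hp'
      exact add_left_cancel hp'
    exact hne (Prod.ext (toLex.injective h1) (toLex.injective h2))
  have hdeg : p.1.degree + p.2.degree = i.degree + j.degree := by
    rw [← map_add, hp, map_add]
  have hnn : ∀ (h : MvPowerSeries (Fin n) F) γ, 0 ≤ ‖coeff γ h‖ * r ^ γ.degree :=
    fun h γ => by positivity
  have hlt : (‖coeff p.1 f‖ * r ^ p.1.degree) * (‖coeff p.2 g‖ * r ^ p.2.degree) <
      (‖coeff i f‖ * r ^ i.degree) * (‖coeff j g‖ * r ^ j.degree) := by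
    rcases hcase with h | h
    · refine (mul_le_mul_of_nonneg_left (hj _) (hnn _ _)).trans_lt
        (mul_lt_mul_of_pos_right (hi' _ h) ?_)
      obtain ⟨δ, hδ⟩ := (MvPowerSeries.ne_zero_iff_exists_coeff_ne_zero g).mp hg0
      exact lt_of_lt_of_le (by positivity) (hj δ)
    · refine (mul_le_mul_of_nonneg_right (hi _) (hnn _ _)).trans_lt
        (mul_lt_mul_of_pos_left (hj' _ h) ?_)
      obtain ⟨δ, hδ⟩ := (MvPowerSeries.ne_zero_iff_exists_coeff_ne_zero f).mp hf0
      exact lt_of_lt_of_le (by positivity) (hi δ)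
  have e1 : (‖coeff p.1 f‖ * r ^ p.1.degree) * (‖coeff p.2 g‖ * r ^ p.2.degree) =
      ‖coeff p.1 f * coeff p.2 g‖ * r ^ (i.degree + j.degree) := by
    rw [← hdeg, norm_mul, pow_add]; ring
  have e2 : (‖coeff i f‖ * r ^ i.degree) * (‖coeff j g‖ * r ^ j.degree) =
      (‖coeff i f‖ * ‖coeff j g‖) * r ^ (i.degree + j.degree) := by
    rw [pow_add]; ring
  rw [e1, e2] at hlt
  exact lt_of_mul_lt_mul_right hlt (by positivity)

/-- A unit of the ring of overconvergent series with constant term one has Gauss norm one. -/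
theorem normLE_one_of_mul_eq_one {R : ℝ} (hR : 0 < R) {u w : MvPowerSeries (Fin n) F}
    (hu : u ∈ Overconv R n F) (hw : w ∈ Overconv R n F) (h : u * w = 1)
    (h1 : constantCoeff u = 1) : NormLE (fun _ => R) 1 u := by
  have key : ∀ f ∈ Overconv R n F, Tendsto (fun γ => ‖coeff γ f‖ * R ^ γ.degree) cofinite (𝓝 0) ∧
      NormLE (fun _ => R) (gaussNorm (fun a : F => ‖a‖) (fun _ => R) f) f := by
    rintro f ⟨ρ, hρ, hρ0, C, hC⟩
    exact ⟨hC.tendsto_of_lt hR hρ,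
      (hC.mono_weight (fun _ => hR) fun _ => hρ.le).normLE_gaussNorm⟩
  have hw1 : constantCoeff w = 1 := by
    have := congrArg constantCoeff h
    rwa [map_mul, h1, one_mul, map_one] at this
  have hle : ∀ f ∈ Overconv R n F, constantCoeff f = 1 →
      1 ≤ gaussNorm (fun a : F => ‖a‖) (fun _ => R) f := by
    intro f hf hf1
    have := (key f hf).2 0
    rwa [wt_zero, coeff_zero_eq_constantCoeff_apply, hf1, norm_one, mul_one] at this
  have hmul := gaussNorm_mul_of_tendsto hR (key u hu).1 (key w hw).1
  have hone : gaussNorm (fun a : F => ‖a‖) (fun _ => R) (1 : MvPowerSeries (Fin n) F) ≤ 1 :=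
    (normLE_one fun _ => hR).gaussNorm_le
  rw [← h, hmul] at hone
  refine (key u hu).2.mono ?_
  nlinarith [hle u hu h1, hle w hw hw1]

end Multiplicative

/-! ### Entire functions as an intersection of rings of overconvergent series -/

section Entire

variable {F : Type*} [NormedField F] [IsUltrametricDist F] {n : ℕ}

theorem exists_normLE_of_mem_entire {f : MvPowerSeries (Fin n) F} (hf : f ∈ Entire n F) {ρ : ℝ}
    (hρ : 0 ≤ ρ) : ∃ C, NormLE (fun _ => ρ) C f := by
  obtain ⟨C, hC⟩ := (hf (fun _ => ρ) fun _ => hρ).bddAbove_range_of_cofinite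
  exact ⟨C, fun γ => hC ⟨γ, rfl⟩⟩

theorem mem_overconv_of_mem_entire {f : MvPowerSeries (Fin n) F} (hf : f ∈ Entire n F) (R : ℝ) :
    f ∈ Overconv R n F :=
  ⟨max R 0 + 1, by grind, by grind, exists_normLE_of_mem_entire hf (by grind)⟩

theorem mem_entire_of_normLE {f : MvPowerSeries (Fin n) F}
    (h : ∀ ρ : ℝ, 0 < ρ → ∃ C, NormLE (fun _ => ρ) C f) : f ∈ Entire n F := by
  intro c hc
  let r := 1 + ∑ i, c i
  have hr : 0 < r := by have := Finset.sum_nonneg fun i (_ : i ∈ Finset.univ) => hc i; positivity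
  obtain ⟨C, hC⟩ := h (r + 1) (by linarith)
  refine squeeze_zero (fun γ => ?_) (fun γ => ?_) (hC.tendsto_of_lt hr (by linarith))
  · exact mul_nonneg (norm_nonneg _) (Finset.prod_nonneg fun i _ => pow_nonneg (hc i) _)
  · rw [← wt_const r γ]
    refine mul_le_mul_of_nonneg_left (Finset.prod_le_prod (fun i _ => pow_nonneg (hc i) _)
      fun i _ => pow_le_pow_left₀ (hc i) ?_ _) (norm_nonneg _)
    have := Finset.single_le_sum (fun i (_ : i ∈ Finset.univ) => hc i) (Finset.mem_univ i)
    simp only [r]; linarith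

theorem mem_entire_of_mem_overconv {f : MvPowerSeries (Fin n) F}
    (h : ∀ N : ℕ, f ∈ Overconv ((N : ℝ) + 1) n F) : f ∈ Entire n F := by
  refine mem_entire_of_normLE fun ρ hρ => ?_
  obtain ⟨N, hN⟩ := exists_nat_ge ρ
  obtain ⟨τ, hτ, -, C, hC⟩ := h N
  exact ⟨C, hC.mono_weight (fun _ => hρ) fun _ => by linarith⟩

theorem overconv_anti {R S : ℝ} (h : R ≤ S) : Overconv S n F ≤ Overconv R n F := by
  rintro f ⟨ρ, hρ, h0⟩
  exact ⟨ρ, h.trans_lt hρ, h0⟩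

/-- Divisibility of entire functions can be checked on all polydiscs. -/
theorem dvd_of_forall_overconv {a b : Entire n F}
    (h : ∀ N : ℕ, ∃ q ∈ Overconv ((N : ℝ) + 1) n F,
      (b : MvPowerSeries (Fin n) F) = q * (a : MvPowerSeries (Fin n) F)) : a ∣ b := by
  by_cases ha : (a : MvPowerSeries (Fin n) F) = 0
  · obtain ⟨q, -, hq⟩ := h 0
    rw [ha, mul_zero] at hq
    exact ⟨0, Subtype.ext (by rw [hq]; simp)⟩
  · choose q hq hqb using h
    have hq0 : ∀ N, q N = q 0 := fun N => mul_right_cancel₀ ha ((hqb N).symm.trans (hqb 0))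
    refine ⟨⟨q 0, mem_entire_of_mem_overconv fun N => hq0 N ▸ hq N⟩, Subtype.ext ?_⟩
    rw [hqb 0, mul_comm]; rfl

end Entire

/-! ### Infinite products of normalized units -/

section Products

variable {F : Type*} [NormedField F] {n : ℕ}

/-- A Schwarz lemma: a series with constant term one and Gauss norm at most one for the radius `R`
differs from one by at most `r / R` for smaller radii `r`. -/
theorem NormLE.sub_one {r R : ℝ} (hr : 0 < r) (h : r ≤ R) {f : MvPowerSeries (Fin n) F}
    (hf : NormLE (fun _ => R) 1 f) (h1 : constantCoeff f = 1) :
    NormLE (fun _ => r) (r / R) (f - 1) := by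
  classical
  have hR : 0 < R := hr.trans_le h
  intro γ
  by_cases hγ : γ = 0
  · subst hγ
    simp [h1, (div_pos hr hR).le]
  · have hγ' : γ.degree ≠ 0 := by rwa [Ne, Finsupp.degree_eq_zero_iff]
    rw [map_sub, coeff_one, if_neg hγ, sub_zero, wt_const]
    have h2 := hf γ
    rw [wt_const] at h2
    calc ‖coeff γ f‖ * r ^ γ.degree = (‖coeff γ f‖ * R ^ γ.degree) * (r / R) ^ γ.degree := by
          rw [div_pow]; field_simp
      _ ≤ 1 * (r / R) ^ γ.degree := by gcongr
      _ ≤ r / R := by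
          rw [one_mul]
          exact pow_le_of_le_one (by positivity) ((div_le_one hR).mpr h) hγ'

variable [IsUltrametricDist F] [CompleteSpace F]

/-- A normalized series of Gauss norm at most one is invertible on smaller polydiscs: this is
Weierstrass division by a series in which the monomial `1` dominates. -/
theorem exists_inv_of_normLE_one {r R : ℝ} (hr : 0 < r) (h : r < R)
    {f : MvPowerSeries (Fin (n + 1)) F} (hf : NormLE (fun _ => R) 1 f) (h1 : constantCoeff f = 1) :
    ∃ g, (∃ C, NormLE (fun _ => r) C g) ∧ g * f = 1 := by
  have hR : 0 < R := hr.trans h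
  have hs : NormLE (fun _ : Fin (n + 1) => r) (r / R * r ^ 0) (f - X 0 ^ 0) := by
    rw [pow_zero, pow_zero, mul_one]
    exact hf.sub_one hr h.le h1
  obtain ⟨q, hq, h'⟩ := exists_shift_sub_mul_eq_zero (fun _ => hr) (div_pos hr hR).le
    ((div_lt_one hR).mpr h) hs (normLE_one fun _ => hr)
  rw [shift_zero_right, sub_eq_zero] at h'
  exact ⟨q, hq, h'.symm⟩

open scoped MvPowerSeries.WithPiTopology in
/-- Normalized series bounded by one on growing polydiscs have a convergent product. -/
theorem exists_tendsto_prod {w : ℕ → MvPowerSeries (Fin n) F} {R : ℝ} (hR : 1 ≤ R)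
    (hw1 : ∀ k, constantCoeff (w k) = 1) (hw : ∀ k : ℕ, NormLE (fun _ => (k : ℝ) + 1) 1 (w k))
    (hwR : ∀ k, NormLE (fun _ => R) 1 (w k)) :
    ∃ U, Tendsto (fun N => ∏ k ∈ Finset.range N, w k) atTop (𝓝 U) ∧
      NormLE (fun _ => R) 1 U ∧ constantCoeff U = 1 := by
  have hR0 : 0 < R := one_pos.trans_le hR
  have hprod : ∀ N, NormLE (fun _ => R) 1 (∏ k ∈ Finset.range N, w k) := fun N =>
    Finset.prod_induction _ (NormLE (fun _ => R) 1)
      (fun f g hf hg => (hf.mul (fun _ => hR0) hg).mono (by norm_num))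
      (normLE_one fun _ => hR0) fun i _ => hwR i
  have hconv : ∀ γ, ∃ c, Tendsto (fun N => coeff γ (∏ k ∈ Finset.range N, w k)) atTop (𝓝 c) := by
    intro γ
    refine cauchySeq_tendsto_of_complete ?_
    refine NonarchimedeanAddGroup.cauchySeq_of_tendsto_sub_nhds_zero ?_
    rw [tendsto_zero_iff_norm_tendsto_zero]
    refine squeeze_zero (fun _ => norm_nonneg _) (fun N => ?_) tendsto_one_div_add_atTop_nhds_zero_nat
    have h1 : NormLE (fun _ => (1 : ℝ)) (1 / ((N : ℝ) + 1)) (w N - 1) :=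
      (hw N).sub_one one_pos (by linarith [N.cast_nonneg (α := ℝ)]) (hw1 N)
    have h2 := h1.mul (fun _ => one_pos) ((hprod N).mono_weight (fun _ => one_pos) fun _ => hR)
    have h3 := h2 γ
    rw [wt_const, one_pow, mul_one, mul_one] at h3
    have h4 : (∏ k ∈ Finset.range N, w k) * w N - ∏ k ∈ Finset.range N, w k =
        (w N - 1) * ∏ k ∈ Finset.range N, w k := by ring
    rw [← map_sub, Finset.prod_range_succ, h4]
    exact h3
  choose U hU using hconv
  refine ⟨U, (WithPiTopology.tendsto_iff_coeff_tendsto _ _ _).mpr hU, fun γ => ?_, ?_⟩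
  · exact le_of_tendsto' ((hU γ).norm.mul_const _) fun N => hprod N γ
  · refine tendsto_nhds_unique (hU 0) ?_
    simp [hw1]

end Products

/-! ### Greatest common divisors of entire functions -/

/-- A decreasing sequence for divisibility is eventually constant up to units. -/
theorem exists_forall_associated_of_antitone_dvd {α : Type*} [CommMonoidWithZero α] [WfDvdMonoid α]
    {G : ℕ → α} (h0 : ∀ k, G k ≠ 0) (h : ∀ k, G (k + 1) ∣ G k) :
    ∃ k₀, ∀ k, k₀ ≤ k → Associated (G k) (G k₀) := by
  obtain ⟨_, ⟨k₀, rfl⟩, hmin⟩ := (wellFounded_dvdNotUnit (α := α)).has_min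
    (Set.range G) ⟨_, 0, rfl⟩
  refine ⟨k₀, fun k hk => ?_⟩
  have hdvd : G k ∣ G k₀ := by
    induction k, hk using Nat.le_induction with
    | base => exact dvd_rfl
    | succ k _ ih => exact (h k).trans ih
  obtain ⟨c, hc⟩ := hdvd
  by_cases hu : IsUnit c
  · rw [hc]; exact associated_mul_unit_right _ _ hu
  · exact absurd ⟨h0 k, c, hu, hc⟩ (hmin (G k) ⟨k, rfl⟩)

section Gluing

variable {F : Type*} [NormedField F] [IsUltrametricDist F] {n : ℕ}

/-- `a` and `b` differ by a unit of the ring of overconvergent series of radius `R`. -/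
def AssocOn (R : ℝ) (a b : MvPowerSeries (Fin n) F) : Prop :=
  ∃ u ∈ Overconv R n F, ∃ w ∈ Overconv R n F, u * w = 1 ∧ b = u * a

theorem AssocOn.exists_normalized {R : ℝ} {a b : MvPowerSeries (Fin n) F} (h : AssocOn R a b) :
    ∃ c : F, c ≠ 0 ∧ ∃ u ∈ Overconv R n F, ∃ w ∈ Overconv R n F, u * w = 1 ∧
      constantCoeff u = 1 ∧ b = C c * (u * a) := by
  obtain ⟨u, hu, w, hw, huw, rfl⟩ := h
  have hC : ∀ c : F, (C c : MvPowerSeries (Fin n) F) ∈ Overconv R n F :=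
    fun c => monomial_mem_overconv 0 c
  have hc : constantCoeff u * constantCoeff w = 1 := by rw [← map_mul, huw, map_one]
  have hCC : (C (constantCoeff u) * C (constantCoeff w) : MvPowerSeries (Fin n) F) = 1 := by
    rw [← map_mul, hc, map_one]
  refine ⟨constantCoeff u, left_ne_zero_of_mul_eq_one hc, C (constantCoeff w) * u,
    mul_mem (hC _) hu, C (constantCoeff u) * w, mul_mem (hC _) hw, ?_, ?_, ?_⟩
  · linear_combination huw * C (constantCoeff u) * C (constantCoeff w) + hCC
  · rw [map_mul, constantCoeff_C, mul_comm]; exact hc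
  · linear_combination (-u * a) * hCC

variable [CompleteSpace F]

open scoped MvPowerSeries.WithPiTopology in
/-- A sequence of series which agree, up to units, on growing polydiscs is represented by one
series. After normalization the units have constant term one, and by the Schwarz lemma their
product converges. -/
theorem exists_assocOn_of_forall_succ {D : ℕ → MvPowerSeries (Fin (n + 1)) F}
    (h : ∀ N : ℕ, AssocOn ((N : ℝ) + 1) (D N) (D (N + 1))) :
    ∃ E : MvPowerSeries (Fin (n + 1)) F, ∀ N : ℕ, AssocOn ((N : ℝ) + 1) (D N) E := by
  choose c hc0 u hu w hw huw hu1 hD using fun N => (h N).exists_normalized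
  have hN : ∀ N : ℕ, (0 : ℝ) < (N : ℝ) + 1 := fun N => by positivity
  have hle : ∀ N : ℕ, NormLE (fun _ => (N : ℝ) + 1) 1 (u N) := fun N =>
    normLE_one_of_mul_eq_one (hN N) (hu N) (hw N) (huw N) (hu1 N)
  have hle' : ∀ (K : ℕ) (R : ℝ), 0 < R → R ≤ (K : ℝ) + 1 → ∀ k,
      NormLE (fun _ => R) 1 (u (K + k)) := fun K R hR hRK k =>
    (hle (K + k)).mono_weight (fun _ => hR) fun _ => by
      push_cast; linarith [k.cast_nonneg (α := ℝ)]
  have hlim : ∀ K : ℕ, ∃ U, Tendsto (fun N => ∏ k ∈ Finset.range N, u (K + k)) atTop (𝓝 U) ∧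
      NormLE (fun _ => (K : ℝ) + 1) 1 U ∧ constantCoeff U = 1 := fun K =>
    exists_tendsto_prod (by linarith [K.cast_nonneg (α := ℝ)]) (fun k => hu1 (K + k))
      (fun k => (hle (K + k)).mono_weight (fun _ => hN k) fun _ => by
        push_cast; linarith [K.cast_nonneg (α := ℝ)])
      (hle' K _ (hN K) le_rfl)
  choose U hU hU1 hUc using hlim
  have hstep : ∀ K, U K = u K * U (K + 1) := by
    intro K
    have h1 := (hU (K + 1)).const_mul (u K)
    refine tendsto_nhds_unique ((hU K).comp (tendsto_add_atTop_nat 1)) (h1.congr fun N => ?_)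
    simp only [Function.comp_apply]
    rw [Finset.prod_range_succ', add_zero, mul_comm]
    congr 1
    exact Finset.prod_congr rfl fun k _ => by rw [add_assoc, add_comm 1 k]
  let κ : ℕ → F := fun N => ∏ k ∈ Finset.range N, c k
  have hκ : ∀ N, κ N ≠ 0 := fun N => Finset.prod_ne_zero_iff.mpr fun k _ => hc0 k
  have hE : ∀ N, C (κ N)⁻¹ * (U N * D N) = U 0 * D 0 := by
    intro N
    induction N with
    | zero => simp [κ]
    | succ N ih =>
      rw [← ih, hD N, hstep N]
      have h1 : (κ N)⁻¹ = (κ (N + 1))⁻¹ * c N := by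
        simp only [κ, Finset.prod_range_succ]
        field_simp [hc0 N]
      rw [h1, map_mul]
      ring
  refine ⟨U 0 * D 0, fun N => ?_⟩
  obtain ⟨V, ⟨B, hV⟩, hVU⟩ := exists_inv_of_normLE_one (r := (N : ℝ) + 3 / 2) (by positivity)
    (by push_cast; linarith) (hU1 (N + 1)) (hUc (N + 1))
  have hUmem : U (N + 1) ∈ Overconv ((N : ℝ) + 1) (n + 1) F :=
    ⟨((N + 1 : ℕ) : ℝ) + 1, by push_cast; linarith, by positivity, 1, hU1 (N + 1)⟩
  have hVmem : V ∈ Overconv ((N : ℝ) + 1) (n + 1) F :=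
    ⟨(N : ℝ) + 3 / 2, by linarith, by positivity, B, hV⟩
  have hC : ∀ c : F, (C c : MvPowerSeries (Fin (n + 1)) F) ∈ Overconv ((N : ℝ) + 1) (n + 1) F :=
    fun c => monomial_mem_overconv 0 c
  have hCC : (C (κ N)⁻¹ * C (κ N) : MvPowerSeries (Fin (n + 1)) F) = 1 := by
    rw [← map_mul, inv_mul_cancel₀ (hκ N), map_one]
  refine ⟨C (κ N)⁻¹ * (u N * U (N + 1)), mul_mem (hC _) (mul_mem (hu N) hUmem),
    C (κ N) * (w N * V), mul_mem (hC _) (mul_mem (hw N) hVmem), ?_, ?_⟩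
  · linear_combination (u N * w N * (V * U (N + 1))) * hCC + (V * U (N + 1)) * huw N + hVU
  · rw [← hE N, hstep N]; ring

variable [IsAlgClosed F]

/-- Any two entire functions have a greatest common divisor. On each polydisc the greatest common
divisors formed on larger polydiscs decrease for divisibility, hence stabilize; the stable values
are compatible and glue. -/
theorem exists_gcd_entire (f g : Entire (n + 1) F) :
    ∃ c : Entire (n + 1) F, ∀ d : Entire (n + 1) F, d ∣ f ∧ d ∣ g ↔ d ∣ c := by
  by_cases hf : f = 0
  · exact ⟨g, fun d => ⟨fun h => h.2, fun h => ⟨hf ▸ dvd_zero d, h⟩⟩⟩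
  let A : ℕ → Subring (MvPowerSeries (Fin (n + 1)) F) := fun N => Overconv ((N : ℝ) + 1) (n + 1) F
  have hufd : ∀ N, UniqueFactorizationMonoid (A N) := fun N =>
    uniqueFactorizationMonoid_overconv F (n + 1) (by positivity)
  have hAle : ∀ {N M : ℕ}, N ≤ M → A M ≤ A N := fun {N M} h =>
    overconv_anti (by simpa using h)
  have hEle : ∀ N, Entire (n + 1) F ≤ A N := fun N x hx => mem_overconv_of_mem_entire hx _
  let ι : ∀ N, Entire (n + 1) F →+* A N := fun N => Subring.inclusion (hEle N)
  let res : ∀ {N M : ℕ}, N ≤ M → A M →+* A N := fun {N M} h => Subring.inclusion (hAle h)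
  have hresι : ∀ {N M : ℕ} (h : N ≤ M) x, res h (ι M x) = ι N x := fun h x => rfl
  have hι0 : ∀ N, ι N f ≠ 0 := fun N h => hf (Subtype.ext (congrArg (Subtype.val : A N → _) h))
  have hG : ∀ N, ∃ G : A N, ∀ d, d ∣ ι N f ∧ d ∣ ι N g ↔ d ∣ G := by
    intro N
    have := hufd N
    let _ := UniqueFactorizationMonoid.toGCDMonoid (A N)
    exact ⟨gcd (ι N f) (ι N g), fun d => (dvd_gcd_iff _ _ _).symm⟩
  choose G hG using hG
  have hG0 : ∀ N, G N ≠ 0 := by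
    intro N h
    have := ((hG N (G N)).mpr dvd_rfl).1
    rw [h, zero_dvd_iff] at this
    exact hι0 N this
  have hGdvd : ∀ {N M : ℕ} (h : N ≤ M), res h (G M) ∣ G N := by
    intro N M h
    obtain ⟨h1, h2⟩ := (hG M (G M)).mpr dvd_rfl
    exact (hG N _).mp ⟨map_dvd (res h) h1, map_dvd (res h) h2⟩
  have hstab : ∀ N, ∃ k₀, ∀ k, k₀ ≤ k → Associated (res (Nat.le_add_right N k) (G (N + k)))
      (res (Nat.le_add_right N k₀) (G (N + k₀))) := by
    intro N
    have := hufd N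
    refine exists_forall_associated_of_antitone_dvd
      (G := fun k => res (Nat.le_add_right N k) (G (N + k))) (fun k h => ?_) fun k => ?_
    · exact hG0 (N + k) (Subtype.ext (congrArg (Subtype.val : A N → _) h))
    · exact map_dvd (res (Nat.le_add_right N k)) (hGdvd (Nat.le_succ (N + k)))
  choose k₀ hk₀ using hstab
  let D : ∀ N, A N := fun N => res (Nat.le_add_right N (k₀ N)) (G (N + k₀ N))
  have hassoc : ∀ N M (h : N ≤ M), N + k₀ N ≤ M → Associated (res h (G M)) (D N) := by
    intro N M h hM
    obtain ⟨k, rfl⟩ := Nat.exists_eq_add_of_le h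
    exact hk₀ N k (by omega)
  have hD : ∀ N : ℕ, AssocOn ((N : ℝ) + 1) (D N : MvPowerSeries (Fin (n + 1)) F) (D (N + 1)) := by
    intro N
    let M := max (N + k₀ N) (N + 1 + k₀ (N + 1))
    have hM1 : N + k₀ N ≤ M := le_max_left _ _
    have hM2 : N + 1 + k₀ (N + 1) ≤ M := le_max_right _ _
    have h1 := hassoc N M (by omega) hM1
    have h2 := (hassoc (N + 1) M (by omega) hM2).map (res (Nat.le_succ N))
    obtain ⟨u, hu⟩ := h1.symm.trans h2
    refine ⟨(u : A N), (u : A N).2, (↑u⁻¹ : A N), (↑u⁻¹ : A N).2, ?_, ?_⟩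
    · exact congrArg Subtype.val u.mul_inv
    · rw [mul_comm]
      exact (congrArg Subtype.val hu).symm
  obtain ⟨E, hE⟩ := exists_assocOn_of_forall_succ hD
  have hEmem : E ∈ Entire (n + 1) F := mem_entire_of_mem_overconv fun N => by
    obtain ⟨u, hu, -, -, -, hE⟩ := hE N
    rw [hE]
    exact mul_mem hu (D N).2
  let c : Entire (n + 1) F := ⟨E, hEmem⟩
  have hc : ∀ N, Associated (D N) (ι N c) := by
    intro N
    obtain ⟨u, hu, w, hw, huw, hE⟩ := hE N
    refine ⟨⟨⟨u, hu⟩, ⟨w, hw⟩, Subtype.ext huw, Subtype.ext ((mul_comm w u).trans huw)⟩,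
      Subtype.ext ?_⟩
    exact (mul_comm _ _).trans hE.symm
  have hlift : ∀ a b : Entire (n + 1) F, (∀ N, ι N a ∣ ι N b) → a ∣ b := by
    intro a b h
    refine dvd_of_forall_overconv fun N => ?_
    obtain ⟨q, hq⟩ := h N
    exact ⟨q, q.2, (congrArg Subtype.val hq).trans (mul_comm _ _)⟩
  have hDdvd : ∀ N, D N ∣ ι N f ∧ D N ∣ ι N g := by
    intro N
    obtain ⟨h1, h2⟩ := (hG (N + k₀ N) (G (N + k₀ N))).mpr dvd_rfl
    exact ⟨map_dvd (res (Nat.le_add_right N (k₀ N))) h1,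
      map_dvd (res (Nat.le_add_right N (k₀ N))) h2⟩
  refine ⟨c, fun d => ⟨fun ⟨h1, h2⟩ => hlift d c fun N => ?_, fun h => ⟨?_, ?_⟩⟩⟩
  · refine Dvd.dvd.trans ?_ (hc N).dvd
    have := (hG (N + k₀ N) _).mp ⟨map_dvd (ι (N + k₀ N)) h1, map_dvd (ι (N + k₀ N)) h2⟩
    exact map_dvd (res (Nat.le_add_right N (k₀ N))) this
  · exact h.trans (hlift c f fun N => (hc N).symm.dvd.trans (hDdvd N).1)
  · exact h.trans (hlift c g fun N => (hc N).symm.dvd.trans (hDdvd N).2)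

end Gluing

/-! ### The absolute values of entire functions -/

section AbsR

variable {F : Type*} [NormedField F] [IsUltrametricDist F] {n : ℕ} {r : ℝ} {f g : Entire n F}

theorem normLE_absR (hr : 0 ≤ r) (f : Entire n F) :
    NormLE (fun _ => r) (absR r f) (f : MvPowerSeries (Fin n) F) := by
  obtain ⟨C, hC⟩ := exists_normLE_of_mem_entire f.2 hr
  exact hC.normLE_gaussNorm

theorem absR_le {C : ℝ} (h : NormLE (fun _ => r) C (f : MvPowerSeries (Fin n) F)) :
    absR r f ≤ C := h.gaussNorm_le

theorem absR_mul (hr : 0 < r) (f g : Entire n F) : absR r (f * g) = absR r f * absR r g := by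
  have ht : ∀ f : Entire n F,
      Tendsto (fun γ => ‖coeff γ (f : MvPowerSeries (Fin n) F)‖ * r ^ γ.degree) cofinite (𝓝 0) := by
    intro f
    obtain ⟨C, hC⟩ := exists_normLE_of_mem_entire f.2 (ρ := r + 1) (by linarith)
    exact hC.tendsto_of_lt hr (by linarith)
  exact gaussNorm_mul_of_tendsto hr (ht f) (ht g)

theorem absR_pos (hr : 0 < r) (hf : f ≠ 0) : 0 < absR r f := by
  obtain ⟨γ, hγ⟩ := (MvPowerSeries.ne_zero_iff_exists_coeff_ne_zero
    (f : MvPowerSeries (Fin n) F)).mp fun h => hf (Subtype.ext h)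
  exact (mul_pos (norm_pos_iff.mpr hγ) (wt_pos (fun _ => hr) γ)).trans_le (normLE_absR hr.le f γ)

theorem absR_nonneg (hr : 0 ≤ r) (f : Entire n F) : 0 ≤ absR r f := (normLE_absR hr f).nonneg

theorem absR_mono {r₀ : ℝ} (hr₀ : 0 < r₀) (h : r₀ ≤ r) (f : Entire n F) :
    absR r₀ f ≤ absR r f :=
  absR_le ((normLE_absR (hr₀.le.trans h) f).mono_weight (fun _ => hr₀) fun _ => h)

/-- Derivatives grow more slowly by a factor `r`, since integers have norm at most one. -/
theorem absR_partialDeriv_le (hr : 0 < r) (j : Fin n) (f : Entire n F) :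
    absR r (partialDeriv j f) ≤ absR r f / r := by
  refine absR_le fun γ => ?_
  have h1 := normLE_absR hr.le f (γ + Finsupp.single j 1)
  rw [wt_add, wt_single, pow_one] at h1
  rw [le_div_iff₀ hr, partialDeriv, coeff_pderiv, norm_mul]
  have h2 : ‖((γ j : F) + 1)‖ ≤ 1 := by
    simpa using IsUltrametricDist.norm_natCast_le_one F (γ j + 1)
  have h3 : 0 ≤ wt (fun _ : Fin n => r) γ := (wt_pos (fun _ => hr) γ).le
  refine le_trans ?_ h1
  rw [mul_assoc ‖_‖, mul_assoc ‖_‖, mul_assoc ‖_ + 1‖]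
  refine mul_le_mul_of_nonneg_left ?_ (norm_nonneg _)
  exact mul_le_of_le_one_left (by positivity) h2

theorem absR_mul_sub_mul_le (hr : 0 < r) (j : Fin n) (f g : Entire n F) :
    absR r (f * partialDeriv j g - g * partialDeriv j f) ≤ absR r f * absR r g / r := by
  refine absR_le ?_
  have h : ∀ f g : Entire n F, NormLE (fun _ => r) (absR r f * absR r g / r)
      ((f * partialDeriv j g : Entire n F) : MvPowerSeries (Fin n) F) := by
    intro f g
    refine (normLE_absR hr.le _).mono ?_
    rw [absR_mul hr, mul_div_assoc]
    exact mul_le_mul_of_nonneg_left (absR_partialDeriv_le hr j g) (absR_nonneg hr.le f)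
  exact (h f g).sub (fun _ => hr) ((h g f).mono (by rw [mul_comm]))

end AbsR

/-! ### Entire functions with vanishing partial derivatives -/

section Derivatives

variable {F : Type*} [NormedField F] [IsUltrametricDist F] {n : ℕ}

theorem partialDeriv_mul (j : Fin n) (f g : Entire n F) :
    partialDeriv j (f * g) = f * partialDeriv j g + g * partialDeriv j f :=
  Subtype.ext ((MvPowerSeries.pderiv F j).leibniz _ _)

theorem partialDeriv_add (j : Fin n) (f g : Entire n F) :
    partialDeriv j (f + g) = partialDeriv j f + partialDeriv j g :=
  Subtype.ext (map_add (MvPowerSeries.pderiv F j) _ _)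

theorem partialDeriv_zero (j : Fin n) : partialDeriv j (0 : Entire n F) = 0 :=
  Subtype.ext (map_zero (MvPowerSeries.pderiv F j))

theorem coeff_mul_natCast_eq_zero {f : Entire n F} {j : Fin n} (h : partialDeriv j f = 0)
    (γ : Fin n →₀ ℕ) : coeff γ (f : MvPowerSeries (Fin n) F) * (γ j : F) = 0 := by
  classical
  by_cases hγ : γ j = 0
  · simp [hγ]
  have hle : Finsupp.single j 1 ≤ γ := by simpa using Nat.one_le_iff_ne_zero.mpr hγ
  have h1 : coeff (γ - Finsupp.single j 1)
      (MvPowerSeries.pderiv F j (f : MvPowerSeries (Fin n) F)) = 0 :=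
    congrArg (fun x : Entire n F => coeff (γ - Finsupp.single j 1) (x : MvPowerSeries (Fin n) F)) h
  rw [coeff_pderiv, tsub_add_cancel_of_le hle] at h1
  have h2 : (((γ - Finsupp.single j 1 : Fin n →₀ ℕ) j : ℕ) : F) + 1 = (γ j : F) := by
    rw [Finsupp.tsub_apply, Finsupp.single_eq_same, ← Nat.cast_add_one,
      Nat.sub_add_cancel (Nat.one_le_iff_ne_zero.mpr hγ)]
  rwa [h2] at h1

theorem isConstant_of_partialDeriv_eq_zero [CharZero F] {f : Entire n F}
    (h : ∀ j, partialDeriv j f = 0) : IsConstant f := by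
  classical
  refine ⟨coeff 0 (f : MvPowerSeries (Fin n) F), ?_⟩
  ext γ
  rw [coeff_C]
  split_ifs with hγ
  · rw [hγ]
  · obtain ⟨j, hj⟩ := DFunLike.ne_iff.mp hγ
    exact (mul_eq_zero.mp (coeff_mul_natCast_eq_zero (h j) γ)).resolve_right
      (Nat.cast_ne_zero.mpr hj)

/-- In characteristic `p` only exponents divisible by `p` occur in a function with vanishing partial
derivatives; the `p`-th roots of its coefficients are those of an entire function. -/
theorem exists_pow_eq_of_partialDeriv_eq_zero [IsAlgClosed F] {p : ℕ} (hp : p.Prime) [CharP F p]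
    {f : Entire n F} (h : ∀ j, partialDeriv j f = 0) : ∃ g : Entire n F, f = g ^ p := by
  have : Fact p.Prime := ⟨hp⟩
  choose g hg using fun γ : Fin n →₀ ℕ =>
    IsAlgClosed.exists_pow_nat_eq (coeff (p • γ) (f : MvPowerSeries (Fin n) F)) hp.pos
  let G : MvPowerSeries (Fin n) F := g
  have hG : ∀ γ, coeff γ G ^ p = coeff (p • γ) (f : MvPowerSeries (Fin n) F) := hg
  have hmem : G ∈ Entire n F := by
    refine mem_entire_of_normLE fun ρ hρ => ?_
    obtain ⟨C, hC⟩ := exists_normLE_of_mem_entire f.2 hρ.le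
    refine ⟨max C 1, fun γ => ?_⟩
    refine le_of_pow_le_pow_left₀ hp.ne_zero (by positivity) ?_
    have h1 := hC (p • γ)
    rw [← hG, norm_pow, wt_const, map_nsmul, smul_eq_mul, mul_comm p, pow_mul, ← mul_pow,
      ← wt_const] at h1
    exact (h1.trans (le_max_left C 1)).trans (le_self_pow₀ (le_max_right C 1) hp.ne_zero)
  refine ⟨⟨G, hmem⟩, Subtype.ext ?_⟩
  change (f : MvPowerSeries (Fin n) F) = G ^ p
  rw [← MvPowerSeries.map_frobenius_expand p hp.ne_zero]
  ext γ
  rw [coeff_map, frobenius_def]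
  by_cases hdvd : ∀ j, p ∣ γ j
  · obtain ⟨δ, rfl⟩ : ∃ δ : Fin n →₀ ℕ, γ = p • δ :=
      ⟨Finsupp.equivFunOnFinite.symm fun j => γ j / p, by
        ext j; simp [Nat.mul_div_cancel' (hdvd j)]⟩
    rw [coeff_expand_smul, hG]
  · push Not at hdvd
    obtain ⟨j, hj⟩ := hdvd
    rw [coeff_expand_of_not_dvd p hp.ne_zero _ hj, zero_pow hp.ne_zero]
    refine (mul_eq_zero.mp (coeff_mul_natCast_eq_zero (h j) γ)).resolve_right ?_
    exact fun h0 => hj ((CharP.cast_eq_zero_iff F p _).mp h0)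

/-- A partial derivative divisible by the function itself vanishes, because it grows more
slowly. -/
theorem partialDeriv_eq_zero_of_dvd {f : Entire n F} {j : Fin n} (h : f ∣ partialDeriv j f) :
    partialDeriv j f = 0 := by
  obtain ⟨k, hk⟩ := h
  by_contra h0
  have hf : f ≠ 0 := by rintro rfl; exact h0 (by rw [hk, zero_mul])
  have hk0 : k ≠ 0 := by rintro rfl; exact h0 (by rw [hk, mul_zero])
  have hk1 := absR_pos one_pos hk0
  let r := 1 + (absR 1 k)⁻¹
  have hr : 0 < r := by positivity
  have hr1 : 1 ≤ r := by have := inv_pos.mpr hk1; simp only [r]; linarith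
  have h1 := absR_partialDeriv_le hr j f
  rw [hk, absR_mul hr, div_eq_mul_inv] at h1
  have h2 : absR r k ≤ r⁻¹ := le_of_mul_le_mul_left h1 (absR_pos hr hf)
  have h3 : absR 1 k ≤ r⁻¹ := (absR_mono one_pos hr1 k).trans h2
  rw [le_inv_comm₀ hk1 hr] at h3
  simp only [r] at h3
  linarith

end Derivatives

/-! ### Radicals and the Wronskian -/

section Radical

theorem exists_lcm_of_finset {A ι : Type*} [CommRing A] [GCDMonoid A] (h : ι → A)
    (s : Finset ι) : ∃ l, ∀ k, (∀ j ∈ s, h j ∣ k) ↔ l ∣ k := by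
  classical
  induction s using Finset.induction_on with
  | empty => exact ⟨1, by simp⟩
  | insert j s _ ih =>
    obtain ⟨l, hl⟩ := ih
    exact ⟨lcm (h j) l, fun k => by rw [Finset.forall_mem_insert, hl, lcm_dvd_iff]⟩

variable {F : Type*} [NormedField F] [IsUltrametricDist F] {n : ℕ}

theorem exists_isRadicalOf [GCDMonoid (Entire n F)] (f : Entire n F) : ∃ R, IsRadicalOf f R := by
  choose h hh using fun j => gcd_dvd_left f (partialDeriv j f)
  obtain ⟨l, hl⟩ := exists_lcm_of_finset h Finset.univ
  refine ⟨l, fun j => gcd f (partialDeriv j f), h, fun j => ⟨gcd_dvd_left _ _, gcd_dvd_right _ _,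
    fun d => dvd_gcd⟩, hh, fun j => (hl l).mpr dvd_rfl j (Finset.mem_univ j), fun k hk => ?_⟩
  exact (hl k).mp fun j _ => hk j

/-- A common divisor of `f₀ f₁ (f₀ + f₁)` and of its partial derivative divides the Wronskian of
`f₀` and `f₁`. -/
theorem dvd_wronskian [DecompositionMonoid (Entire n F)] {f₀ f₁ g : Entire n F} {j : Fin n}
    (hcop : IsRelPrime f₀ f₁) (hg : g ∣ f₀ * f₁ * (f₀ + f₁))
    (hg' : g ∣ partialDeriv j (f₀ * f₁ * (f₀ + f₁))) :
    g ∣ f₀ * partialDeriv j f₁ - f₁ * partialDeriv j f₀ := by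
  have h02 : IsRelPrime f₀ (f₀ + f₁) := fun d h h' => hcop h ((dvd_add_right h).mp h')
  have h12 : IsRelPrime f₁ (f₀ + f₁) := fun d h h' => hcop ((dvd_add_left h).mp h') h
  obtain ⟨b, a₂, hb, ha₂, rfl⟩ := exists_dvd_and_dvd_of_dvd_mul hg
  obtain ⟨a₀, a₁, ha₀, ha₁, rfl⟩ := exists_dvd_and_dvd_of_dvd_mul hb
  rw [partialDeriv_mul, partialDeriv_mul] at hg'
  set d₀ := partialDeriv j f₀
  set d₁ := partialDeriv j f₁
  have hd₂ : partialDeriv j (f₀ + f₁) = d₀ + d₁ := partialDeriv_add j f₀ f₁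
  rw [hd₂] at hg'
  have rel : ∀ {a b c d : Entire n F}, a ∣ c → b ∣ d → IsRelPrime c d → IsRelPrime a b :=
    fun ha hb h x hx hy => h (hx.trans ha) (hy.trans hb)
  -- Each factor `a_i` divides `f_i` and is prime to the other two functions, so by the Leibniz rule
  -- it divides the derivative of `f_i`.
  have hd0 : a₀ ∣ d₀ := by
    have h1 : a₀ ∣ (f₁ * (f₀ + f₁)) * d₀ := by
      have h2 := ((dvd_mul_right a₀ a₁).mul_right a₂).trans hg'
      have h3 : (f₁ * (f₀ + f₁)) * d₀ = (f₀ * f₁ * (d₀ + d₁) + (f₀ + f₁) * (f₀ * d₁ + f₁ * d₀)) -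
          f₀ * (f₁ * (d₀ + d₁) + (f₀ + f₁) * d₁) := by ring
      rw [h3]
      exact dvd_sub h2 (ha₀.mul_right _)
    exact ((rel ha₀ dvd_rfl hcop).mul_right (rel ha₀ dvd_rfl h02)).dvd_of_dvd_mul_left h1
  have hd1 : a₁ ∣ d₁ := by
    have h1 : a₁ ∣ (f₀ * (f₀ + f₁)) * d₁ := by
      have h2 := ((dvd_mul_left a₁ a₀).mul_right a₂).trans hg'
      have h3 : (f₀ * (f₀ + f₁)) * d₁ = (f₀ * f₁ * (d₀ + d₁) + (f₀ + f₁) * (f₀ * d₁ + f₁ * d₀)) -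
          f₁ * (f₀ * (d₀ + d₁) + (f₀ + f₁) * d₀) := by ring
      rw [h3]
      exact dvd_sub h2 (ha₁.mul_right _)
    exact ((rel ha₁ dvd_rfl hcop.symm).mul_right (rel ha₁ dvd_rfl h12)).dvd_of_dvd_mul_left h1
  have hd2 : a₂ ∣ d₀ + d₁ := by
    have h1 : a₂ ∣ (f₀ * f₁) * (d₀ + d₁) := by
      have h2 := (dvd_mul_left a₂ (a₀ * a₁)).trans hg'
      exact (dvd_add_left (ha₂.mul_right _)).mp h2
    exact ((rel ha₂ dvd_rfl h02.symm).mul_right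
      (rel ha₂ dvd_rfl h12.symm)).dvd_of_dvd_mul_left h1
  refine IsRelPrime.mul_dvd ?_ (IsRelPrime.mul_dvd (rel ha₀ ha₁ hcop) ?_ ?_) ?_
  · exact (rel ha₀ ha₂ h02).mul_left (rel ha₁ ha₂ h12)
  · exact dvd_sub (ha₀.mul_right _) (hd0.mul_left _)
  · exact dvd_sub (hd1.mul_left _) (ha₁.mul_right _)
  · have : f₀ * d₁ - f₁ * d₀ = f₀ * (d₀ + d₁) - (f₀ + f₁) * d₀ := by ring
    rw [this]
    exact dvd_sub (hd2.mul_left _) (ha₂.mul_right _)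

/-- The radical inequality, given a nonvanishing Wronskian. If `f₀ f₁ f₂ = g h` with `g` the greatest
common divisor, then `g` divides the Wronskian, which grows at most like `|f_a| |f_b| / r` for any
two of the three functions; hence the third grows at most like `|h| / r`, up to a constant. -/
theorem exists_log_absR_le [DecompositionMonoid (Entire n F)] {f₀ f₁ R : Entire n F} {j : Fin n}
    (hcop : IsRelPrime f₀ f₁) (hW : f₀ * partialDeriv j f₁ - f₁ * partialDeriv j f₀ ≠ 0)
    (hR : IsRadicalOf (f₀ * f₁ * (f₀ + f₁)) R) {r₀ : ℝ} (hr₀ : 0 < r₀) :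
    ∃ C : ℝ, ∀ r : ℝ, r₀ ≤ r →
      max (max (Real.log (absR r f₀)) (Real.log (absR r f₁))) (Real.log (absR r (f₀ + f₁)))
        ≤ Real.log (absR r R) - Real.log r + C := by
  set d₀ := partialDeriv j f₀ with hd₀
  set d₁ := partialDeriv j f₁ with hd₁
  set W := f₀ * d₁ - f₁ * d₀
  have hd₂ : partialDeriv j (f₀ + f₁) = d₀ + d₁ := partialDeriv_add j f₀ f₁
  have hW02 : f₀ * partialDeriv j (f₀ + f₁) - (f₀ + f₁) * d₀ = W := by rw [hd₂]; ring
  have hW21 : (f₀ + f₁) * d₁ - f₁ * partialDeriv j (f₀ + f₁) = W := by rw [hd₂]; ring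
  have h0 : f₀ ≠ 0 := by
    rintro rfl
    exact hW (by simp only [W, hd₀, partialDeriv_zero]; ring)
  have h1 : f₁ ≠ 0 := by
    rintro rfl
    exact hW (by simp only [W, hd₁, partialDeriv_zero]; ring)
  have h2 : f₀ + f₁ ≠ 0 := by
    intro h
    exact hW (by rw [← hW02, h, partialDeriv_zero]; ring)
  obtain ⟨g, h, hg, hgh, hhR, hRle⟩ := hR
  have hR0 : R ≠ 0 := by
    rintro rfl
    have := hRle (f₀ * f₁ * (f₀ + f₁)) fun i => ⟨g i, by rw [hgh i]; ring⟩
    exact mul_ne_zero (mul_ne_zero h0 h1) h2 (zero_dvd_iff.mp this)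
  obtain ⟨k, hk⟩ := dvd_wronskian hcop (hg j).1 (hg j).2.1
  obtain ⟨l, hl⟩ := hhR j
  change W = g j * k at hk
  have hk0 : k ≠ 0 := by rintro rfl; exact hW (by rw [hk, mul_zero])
  have hl0 : l ≠ 0 := by rintro rfl; exact hR0 (by rw [hl, mul_zero])
  have hκ := absR_pos hr₀ hk0
  have hlam := absR_pos hr₀ hl0
  refine ⟨-Real.log (absR r₀ k * absR r₀ l), fun r hr => ?_⟩
  have hr0 : 0 < r := hr₀.trans_le hr
  have hkr := absR_mono hr₀ hr k
  have hlr := absR_mono hr₀ hr l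
  have hkr0 := absR_nonneg hr0.le k
  have hlr0 := absR_nonneg hr0.le l
  have hprod : absR r f₀ * absR r f₁ * absR r (f₀ + f₁) = absR r (g j) * absR r (h j) := by
    rw [← absR_mul hr0, ← absR_mul hr0, ← absR_mul hr0, ← hgh j]
  have hWr : absR r W = absR r (g j) * absR r k := by rw [hk, absR_mul hr0]
  have hRr : absR r R = absR r (h j) * absR r l := by rw [hl, absR_mul hr0]
  have hhj := absR_nonneg hr0.le (h j)
  have hgj := absR_nonneg hr0.le (g j)
  -- Cancelling two of the three factors leaves a bound for the remaining one.
  have key : ∀ a b c : Entire n F, a ≠ 0 → b ≠ 0 → c ≠ 0 →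
      absR r a * absR r b * absR r c = absR r (g j) * absR r (h j) →
      absR r W ≤ absR r a * absR r b / r →
      Real.log (absR r c) ≤ Real.log (absR r R) - Real.log r +
        -Real.log (absR r₀ k * absR r₀ l) := by
    intro a b c ha hb hc habc hWab
    have hab : 0 < absR r a * absR r b := mul_pos (absR_pos hr0 ha) (absR_pos hr0 hb)
    have hle : absR r c * (r * (absR r₀ k * absR r₀ l)) ≤ absR r R := by
      refine le_of_mul_le_mul_left ?_ hab
      rw [le_div_iff₀ hr0, hWr] at hWab
      calc absR r a * absR r b * (absR r c * (r * (absR r₀ k * absR r₀ l)))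
          = (absR r (g j) * absR r₀ k * r) * (absR r (h j) * absR r₀ l) := by
            rw [← mul_assoc _ (absR r c), habc]; ring
        _ ≤ (absR r (g j) * absR r k * r) * (absR r (h j) * absR r l) := by
            gcongr
        _ ≤ absR r a * absR r b * (absR r (h j) * absR r l) :=
            mul_le_mul_of_nonneg_right hWab (by positivity)
        _ = absR r a * absR r b * absR r R := by rw [hRr]
    have hcpos := absR_pos hr0 hc
    have hlog := Real.log_le_log (by positivity) hle
    rw [Real.log_mul hcpos.ne' (by positivity), Real.log_mul hr0.ne' (by positivity)] at hlog
    linarith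
  refine max_le (max_le ?_ ?_) ?_
  · refine key (f₀ + f₁) f₁ f₀ h2 h1 h0 (by rw [← hprod]; ring) ?_
    rw [← hW21]; exact absR_mul_sub_mul_le hr0 j _ _
  · refine key f₀ (f₀ + f₁) f₁ h0 h2 h1 (by rw [← hprod]; ring) ?_
    rw [← hW02]; exact absR_mul_sub_mul_le hr0 j _ _
  · exact key f₀ f₁ (f₀ + f₁) h0 h1 h2 hprod (absR_mul_sub_mul_le hr0 j _ _)

end Radical

end

end NonArchEntire

open NonArchEntire

theorem mainTheorem3 {F : Type*} [NormedField F] [IsUltrametricDist F] [CompleteSpace F]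
    [IsAlgClosed F] (m : ℕ) (f₀ f₁ f₂ : NonArchEntire.Entire m F)
    (hsum : f₂ = f₀ + f₁) (hcop : IsRelPrime f₀ f₁)
    (hchar0 : CharZero F →
      ¬ NonArchEntire.IsConstant f₀ ∨ ¬ NonArchEntire.IsConstant f₁)
    (hcharp : ∀ p : ℕ, p.Prime → CharP F p →
      (¬ ∃ g : NonArchEntire.Entire m F, f₀ = g ^ p) ∨
      (¬ ∃ g : NonArchEntire.Entire m F, f₁ = g ^ p)) :
    (∃ R : NonArchEntire.Entire m F, NonArchEntire.IsRadicalOf (f₀ * f₁ * f₂) R) ∧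
    ∀ R : NonArchEntire.Entire m F, NonArchEntire.IsRadicalOf (f₀ * f₁ * f₂) R →
      ∀ r₀ : ℝ, 0 < r₀ → ∃ C : ℝ, ∀ r : ℝ, r₀ ≤ r →
        max (max (Real.log (NonArchEntire.absR r f₀)) (Real.log (NonArchEntire.absR r f₁)))
            (Real.log (NonArchEntire.absR r f₂))
          ≤ Real.log (NonArchEntire.absR r R) - Real.log r + C := by
  classical
  subst hsum
  have hder : ¬ ∀ j, partialDeriv j f₀ = 0 ∧ partialDeriv j f₁ = 0 := by
    intro h
    obtain ⟨p, hp⟩ := CharP.exists F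
    rcases CharP.char_is_prime_or_zero F p with hprime | rfl
    · exact (hcharp p hprime hp).elim
        (fun h' => h' (exists_pow_eq_of_partialDeriv_eq_zero hprime fun j => (h j).1))
        fun h' => h' (exists_pow_eq_of_partialDeriv_eq_zero hprime fun j => (h j).2)
    · have := CharP.charP_to_charZero F
      exact (hchar0 this).elim
        (fun h' => h' (isConstant_of_partialDeriv_eq_zero fun j => (h j).1))
        fun h' => h' (isConstant_of_partialDeriv_eq_zero fun j => (h j).2)
  -- In zero variables all functions are constant, so all of their derivatives vanish.
  rcases m with _ | n
  · exact absurd (fun j => j.elim0) hder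
  let _ : GCDMonoid (Entire (n + 1) F) := gcdMonoidOfExistsGCD exists_gcd_entire
  obtain ⟨j, hj⟩ : ∃ j, f₀ * partialDeriv j f₁ - f₁ * partialDeriv j f₀ ≠ 0 := by
    -- If the Wronskian vanishes, `f₀` and `f₁` divide their own derivatives by coprimality.
    by_contra! hW
    refine hder fun j => ⟨partialDeriv_eq_zero_of_dvd ?_, partialDeriv_eq_zero_of_dvd ?_⟩
    · exact hcop.dvd_of_dvd_mul_left ⟨partialDeriv j f₁, (sub_eq_zero.mp (hW j)).symm⟩
    · exact hcop.symm.dvd_of_dvd_mul_left ⟨partialDeriv j f₀, sub_eq_zero.mp (hW j)⟩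
  exact ⟨exists_isRadicalOf _, fun R hR r₀ hr₀ => exists_log_absR_le hcop hj hR hr₀⟩
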